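/- A metric Lie algebra is a finite-dimensional real Lie algebra $\mathfrak d$ with a non-degenerate symmetric bilinear form $\langle\cdot,\cdot\rangle$ such that $\langle[x,y],z\rangle=-\langle y,[x,z]\rangle$; signature $(p,q)$ means $p$ minus and $q$ plus signs. It is indecomposable if it is not the orthogonal direct sum of two non-zero ideals. Isomorphisms of metric Lie algebras are isometric Lie algebra isomorphisms. For a metric Lie algebra $\mathfrak g$ and an antisymmetric derivation $A$ of $\mathfrak g$, the double extension $\mathfrak d_A(\mathfrak g,\mathbb R)$ is the vector space $\mathbb R\alpha\oplus\mathfrak g\oplus\mathbb R H$ with $\alpha$ central, $[X,Y]=\langle AX,Y\rangle_{\mathfrak g}\,\alpha+[X,Y]_{\mathfrak g}$, $[H,X]=AX$ for $X,Y\in\mathfrak g$, and with the scalar product that extends $\langle\cdot,\cdot\rangle_{\mathfrak g}$ and satisfies $\langle\alpha,H\rangle=1$, $\langle\alpha,\alpha\rangle=\langle H,H\rangle=0$, $\alpha,H\perp\mathfrak g$. If $\mathfrak g=\mathbb R^{p+q}$ is abelian with scalar product $\mathrm{diag}(-1,\dots,-1,1,\dots,1)$ of signature $(p,q)$ and $A\in\mathfrak{so}(p,q)$,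 it is denoted by $\underline A(p,q)$. Put $$L_2=\begin{pmatrix}0&1\\1&0\end{pmatrix},\quad L_3=\begin{pmatrix}0&1&0\\1&0&1\\0&-1&0\end{pmatrix},\quad L_{2,\lambda}=\begin{pmatrix}L_2&0\\0&A_\lambda\end{pmatrix},\quad L_{3,\lambda}=\begin{pmatrix}L_3&0\\0&A_\lambda\end{pmatrix},$$ where, for $\lambda=(\lambda_1,\dots,\lambda_l)$, $A_\lambda$ is block diagonal with blocks $\begin{pmatrix}0&-\lambda_r\\ \lambda_r&0\end{pmatrix}$, $r=1,\dots,l$. **Proposition.** Let $n\ge 2$ and let $\mathfrak d$ be an indecomposable metric Lie algebra of signature $(2,n-2)$. Suppose that (a) the centre of $\mathfrak d$ is one-dimensional, or (b) $\mathfrak d$ is isomorphic to a double extension $\mathfrak d_A(\mathfrak g,\mathbb R)$ of an abelian metric Lie algebra $\mathfrak g$ of Lorentzian signature $(1,n-3)$ by an antisymmetric endomorphism $A$ of $\mathfrak g$. Then $n\ge 4$ and $\mathfrak d$ is isomorphic, as a metric Lie algebra, to 1. $\underline L_2(1,1)$ if $n=4$, 2. $\underline L_3(1,2)$ if $n=5$,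 3. $\underline L_{2,\lambda}(1,n-3)$ for some $\lambda$ with $0<\lambda_1\le\dots\le\lambda_l$ and $l=(n-4)/2$, if $n>5$ is even, 4. $\underline L_{3,\lambda}(1,n-3)$ for some $\lambda$ with $0<\lambda_1\le\dots\le\lambda_l$ and $l=(n-5)/2$, if $n>5$ is odd. -/

import Mathlib

namespace MetricLie

/-- An ad-invariant scalar product on a real Lie algebra: a non-degenerate symmetric bilinear form
`⟨·, ·⟩` with `⟨[x, y], z⟩ = -⟨y, [x, z]⟩`. A real Lie algebra with such a scalar product is a
*metric Lie algebra*. -/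
structure ScalarProduct (L : Type*) [LieRing L] [LieAlgebra ℝ L] where
  form : LinearMap.BilinForm ℝ L
  symm : form.IsSymm
  nondegenerate : form.Nondegenerate
  invariant : form.lieInvariant L

/-- Signature `(p, q)`: `p` minus signs and `q` plus signs (in this order). -/
def HasSignature {L : Type*} [LieRing L] [LieAlgebra ℝ L] (Φ : ScalarProduct L) (p q : ℕ) : Prop :=
  sigNeg (LinearMap.BilinMap.toQuadraticMap Φ.form) = p ∧
    sigPos (LinearMap.BilinMap.toQuadraticMap Φ.form) = q

/-- A metric Lie algebra is indecomposable if it is not the orthogonal direct sum of two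
non-zero ideals (on which the scalar product is then automatically non-degenerate). -/
def IsIndecomposable {L : Type*} [LieRing L] [LieAlgebra ℝ L] (Φ : ScalarProduct L) : Prop :=
  ¬ ∃ I J : LieIdeal ℝ L, I ≠ ⊥ ∧ J ≠ ⊥ ∧ IsCompl I J ∧ ∀ x ∈ I, ∀ y ∈ J, Φ.form x y = 0

/-- Isomorphism of metric Lie algebras: an isometric isomorphism of Lie algebras. -/
def IsIsomorphic {L L' : Type*} [LieRing L] [LieAlgebra ℝ L] [LieRing L'] [LieAlgebra ℝ L']
    (Φ : ScalarProduct L) (Ψ : ScalarProduct L') : Prop :=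
  ∃ e : L ≃ₗ⁅ℝ⁆ L', ∀ x y : L, Ψ.form (e x) (e y) = Φ.form x y

/-- An antisymmetric derivation of a metric Lie algebra. -/
structure AntisymmDerivation {L : Type*} [LieRing L] [LieAlgebra ℝ L] (Φ : ScalarProduct L) where
  der : LieDerivation ℝ L L
  antisymm : ∀ x y : L, Φ.form (der x) y = -Φ.form x (der y)

/-! ### The double extension `𝔡_A(𝔤, ℝ)` of a metric Lie algebra by `ℝ` -/

/-- The vector space `ℝα ⊕ 𝔤 ⊕ ℝH` underlying the double extension of `𝔤` by `ℝ` defined by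
the antisymmetric derivation `A`; the triple `(a, x, s)` stands for `aα + x + sH`. -/
@[nolint unusedArguments]
def DoubleExtension {L : Type*} [LieRing L] [LieAlgebra ℝ L] {Φ : ScalarProduct L}
    (_A : AntisymmDerivation Φ) : Type _ := ℝ × L × ℝ

namespace DoubleExtension

variable {L : Type*} [LieRing L] [LieAlgebra ℝ L] {Φ : ScalarProduct L} (A : AntisymmDerivation Φ)

instance : AddCommGroup (DoubleExtension A) := inferInstanceAs (AddCommGroup (ℝ × L × ℝ))

instance : Module ℝ (DoubleExtension A) := inferInstanceAs (Module ℝ (ℝ × L × ℝ))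

/-- The commutator: `α` is central, `[x, y] = ⟨Ax, y⟩α + [x, y]_𝔤` and `[H, x] = Ax` for
`x, y ∈ 𝔤`. -/
instance : Bracket (DoubleExtension A) (DoubleExtension A) where
  bracket u v :=
    (Φ.form (A.der u.2.1) v.2.1,
      ⁅u.2.1, v.2.1⁆ + u.2.2 • A.der v.2.1 - v.2.2 • A.der u.2.1,
      (0 : ℝ))

theorem bracket_def (u v : DoubleExtension A) :
    ⁅u, v⁆ = ((Φ.form (A.der u.2.1) v.2.1,
      ⁅u.2.1, v.2.1⁆ + u.2.2 • A.der v.2.1 - v.2.2 • A.der u.2.1, (0 : ℝ)) : ℝ × L × ℝ) := rfl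

@[ext] theorem ext' {u v : DoubleExtension A} (h1 : u.1 = v.1) (h2 : u.2.1 = v.2.1)
    (h3 : u.2.2 = v.2.2) : u = v := Prod.ext h1 (Prod.ext h2 h3)

@[simp] theorem add_fst (u v : DoubleExtension A) : (u + v).1 = u.1 + v.1 := rfl
@[simp] theorem add_snd_fst (u v : DoubleExtension A) : (u + v).2.1 = u.2.1 + v.2.1 := rfl
@[simp] theorem add_snd_snd (u v : DoubleExtension A) : (u + v).2.2 = u.2.2 + v.2.2 := rfl
@[simp] theorem smul_fst (c : ℝ) (u : DoubleExtension A) : (c • u).1 = c * u.1 := rfl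
@[simp] theorem smul_snd_fst (c : ℝ) (u : DoubleExtension A) : (c • u).2.1 = c • u.2.1 := rfl
@[simp] theorem smul_snd_snd (c : ℝ) (u : DoubleExtension A) : (c • u).2.2 = c * u.2.2 := rfl
@[simp] theorem zero_fst : (0 : DoubleExtension A).1 = 0 := rfl
@[simp] theorem zero_snd_fst : (0 : DoubleExtension A).2.1 = 0 := rfl
@[simp] theorem zero_snd_snd : (0 : DoubleExtension A).2.2 = 0 := rfl
@[simp] theorem bracket_fst (u v : DoubleExtension A) :
    ⁅u, v⁆.1 = Φ.form (A.der u.2.1) v.2.1 := rfl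
@[simp] theorem bracket_snd_fst (u v : DoubleExtension A) :
    ⁅u, v⁆.2.1 = ⁅u.2.1, v.2.1⁆ + u.2.2 • A.der v.2.1 - v.2.2 • A.der u.2.1 := rfl
@[simp] theorem bracket_snd_snd (u v : DoubleExtension A) : ⁅u, v⁆.2.2 = 0 := rfl

theorem form_der_self (x : L) : Φ.form (A.der x) x = 0 := by
  have h := A.antisymm x x
  rw [Φ.symm.eq x (A.der x)] at h
  linarith

theorem leibniz_fst (x y z : L) (s t r : ℝ) :
    Φ.form (A.der x) (⁅y, z⁆ + t • A.der z - r • A.der y) =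
      Φ.form (A.der (⁅x, y⁆ + s • A.der y - t • A.der x)) z +
        Φ.form (A.der y) (⁅x, z⁆ + s • A.der z - r • A.der x) := by
  have h2 := A.antisymm y (A.der z)
  have h3 := A.antisymm (A.der x) z
  have h4 := A.antisymm (A.der y) z
  have h6 := Φ.symm.eq (A.der x) (A.der y)
  have h7 := Φ.invariant x (A.der y) z
  have h8 := Φ.invariant y (A.der x) z
  have h9 : A.der ⁅x, y⁆ = ⁅x, A.der y⁆ - ⁅y, A.der x⁆ := A.der.leibniz' x y
  simp only [map_add, map_sub, map_smul, LinearMap.add_apply, LinearMap.sub_apply,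
    LinearMap.smul_apply, smul_eq_mul, h9, h7, h8, h3, h4, h6]
  ring

theorem leibniz_snd (x y z : L) (s t r : ℝ) :
    ⁅x, ⁅y, z⁆ + t • A.der z - r • A.der y⁆ + s • A.der (⁅y, z⁆ + t • A.der z - r • A.der y)
        - (0 : ℝ) • A.der x =
      (⁅⁅x, y⁆ + s • A.der y - t • A.der x, z⁆ + (0 : ℝ) • A.der z
        - r • A.der (⁅x, y⁆ + s • A.der y - t • A.der x)) +
      (⁅y, ⁅x, z⁆ + s • A.der z - r • A.der x⁆ + t • A.der (⁅x, z⁆ + s • A.der z - r • A.der x)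
        - (0 : ℝ) • A.der y) := by
  have h1 := leibniz_lie x y z
  have h2 : ⁅A.der x, z⁆ = -⁅z, A.der x⁆ := (lie_skew _ _).symm
  have h3 : ⁅A.der y, z⁆ = -⁅z, A.der y⁆ := (lie_skew _ _).symm
  simp only [map_add, map_sub, map_smul, lie_add, lie_sub, add_lie, sub_lie, lie_smul, smul_lie,
    LieDerivation.apply_lie_eq_sub, h1, h2, h3]
  module

instance : LieRing (DoubleExtension A) where
  add_lie u v w := by
    ext
    · simp
    · simp only [bracket_snd_fst, add_snd_fst, add_snd_snd, add_lie, map_add, add_smul, smul_add]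
      abel
    · simp
  lie_add u v w := by
    ext
    · simp
    · simp only [bracket_snd_fst, add_snd_fst, add_snd_snd, lie_add, map_add, add_smul, smul_add]
      abel
    · simp
  lie_self u := by
    ext
    · simp [form_der_self]
    · simp
    · simp
  leibniz_lie u v w := by
    ext
    · exact leibniz_fst A _ _ _ _ _ _
    · exact leibniz_snd A _ _ _ _ _ _
    · simp

instance : LieAlgebra ℝ (DoubleExtension A) where
  lie_smul c u v := by
    ext
    · simp
    · simp only [bracket_snd_fst, smul_snd_fst, smul_snd_snd, lie_smul, map_smul]
      module
    · simp

/-- The scalar product of the double extension: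
`⟨aα + x + sH, bα + y + tH⟩ = ⟨x, y⟩ + a t + b s`. -/
def form : LinearMap.BilinForm ℝ (DoubleExtension A) :=
  LinearMap.mk₂ ℝ (fun u v => Φ.form u.2.1 v.2.1 + u.1 * v.2.2 + v.1 * u.2.2)
    (fun u v w => by simp; ring) (fun c u v => by simp; ring)
    (fun u v w => by simp; ring) (fun c u v => by simp; ring)

@[simp] theorem form_apply (u v : DoubleExtension A) :
    form A u v = Φ.form u.2.1 v.2.1 + u.1 * v.2.2 + v.1 * u.2.2 := rfl

theorem form_symm (u v : DoubleExtension A) : form A u v = form A v u := by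
  simp only [form_apply, Φ.symm.eq u.2.1 v.2.1]
  ring

theorem form_separating (u : DoubleExtension A) (h : ∀ v, form A u v = 0) : u = 0 := by
  have h' (a : ℝ) (x : L) (s : ℝ) : Φ.form u.2.1 x + u.1 * s + a * u.2.2 = 0 :=
    h ((a, x, s) : ℝ × L × ℝ)
  ext
  · simpa using h' 0 0 1
  · exact Φ.nondegenerate.1 _ fun y => by simpa using h' 0 y 0
  · simpa using h' 1 0 0

/-- The double extension as a metric Lie algebra. -/
def scalarProduct : ScalarProduct (DoubleExtension A) where
  form := form A
  symm := ⟨form_symm A⟩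
  nondegenerate := ⟨form_separating A, fun v h =>
    form_separating A v fun u => (form_symm A v u).trans (h u)⟩
  invariant u v w := by
    have h1 := Φ.invariant u.2.1 v.2.1 w.2.1
    have h2 := A.antisymm v.2.1 w.2.1
    have h4 := Φ.symm.eq v.2.1 (A.der u.2.1)
    simp only [form_apply, bracket_fst, bracket_snd_fst, bracket_snd_snd, map_add, map_sub,
      map_smul, LinearMap.add_apply, LinearMap.sub_apply, LinearMap.smul_apply, smul_eq_mul,
      h1, h2, h4]
    ring

end DoubleExtension

/-! ### Abelian metric Lie algebras and their double extensions `A(p, q)` -/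

/-- The abelian Lie algebra `ℝ^ι`, which will carry the scalar product `diag(ε)`. -/
@[nolint unusedArguments]
def PseudoEuclidean {ι : Type*} (_ε : ι → ℤˣ) : Type _ := ι → ℝ

namespace PseudoEuclidean

variable {ι : Type*} (ε : ι → ℤˣ)

instance : AddCommGroup (PseudoEuclidean ε) := inferInstanceAs (AddCommGroup (ι → ℝ))

instance : Module ℝ (PseudoEuclidean ε) := inferInstanceAs (Module ℝ (ι → ℝ))

instance : LieRing (PseudoEuclidean ε) where
  bracket _ _ := 0
  add_lie _ _ _ := (add_zero _).symm
  lie_add _ _ _ := (add_zero _).symm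
  lie_self _ := rfl
  leibniz_lie _ _ _ := (add_zero _).symm

theorem lie_eq_zero (x y : PseudoEuclidean ε) : ⁅x, y⁆ = 0 := rfl

instance : LieAlgebra ℝ (PseudoEuclidean ε) where
  lie_smul c _ _ := (smul_zero c).symm

variable {ε} in
theorem add_apply (x y : PseudoEuclidean ε) (i : ι) : (x + y) i = x i + y i := rfl

variable {ε} in
theorem smul_apply (c : ℝ) (x : PseudoEuclidean ε) (i : ι) : (c • x) i = c * x i := rfl

variable [Fintype ι]

/-- The scalar product `⟨x, y⟩ = ∑ i, ε i * x i * y i`, for which the standard basis is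
orthonormal. -/
def form : LinearMap.BilinForm ℝ (PseudoEuclidean ε) :=
  LinearMap.mk₂ ℝ (fun x y : PseudoEuclidean ε => ∑ i, ((ε i : ℤ) : ℝ) * x i * y i)
    (fun x y z => by
      rw [← Finset.sum_add_distrib]
      exact Finset.sum_congr rfl fun i _ => by rw [add_apply]; ring)
    (fun c x y => by
      rw [smul_eq_mul, Finset.mul_sum]
      exact Finset.sum_congr rfl fun i _ => by rw [smul_apply]; ring)
    (fun x y z => by
      rw [← Finset.sum_add_distrib]
      exact Finset.sum_congr rfl fun i _ => by rw [add_apply]; ring)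
    (fun c x y => by
      rw [smul_eq_mul, Finset.mul_sum]
      exact Finset.sum_congr rfl fun i _ => by rw [smul_apply]; ring)

theorem form_apply (x y : PseudoEuclidean ε) :
    form ε x y = ∑ i, ((ε i : ℤ) : ℝ) * x i * y i := rfl

theorem form_symm (x y : PseudoEuclidean ε) : form ε x y = form ε y x := by
  simp only [form_apply]
  exact Finset.sum_congr rfl fun i _ => by ring

theorem form_separating (x : PseudoEuclidean ε) (h : ∀ y, form ε x y = 0) : x = 0 := by
  funext i
  classical
  have hi (y : ι → ℝ) : ∑ j, ((ε j : ℤ) : ℝ) * x j * y j = 0 := h y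
  have key : ((ε i : ℤ) : ℝ) * x i = 0 := by simpa [Pi.single_apply] using hi (Pi.single i 1)
  have hε : ((ε i : ℤ) : ℝ) ≠ 0 := Int.cast_ne_zero.mpr (Units.ne_zero (ε i))
  exact (mul_eq_zero.mp key).resolve_left hε

/-- `ℝ^ι` with `diag(ε)` as an abelian metric Lie algebra. -/
def scalarProduct : ScalarProduct (PseudoEuclidean ε) where
  form := form ε
  symm := ⟨form_symm ε⟩
  nondegenerate := ⟨form_separating ε, fun y h =>
    form_separating ε y fun x => (form_symm ε y x).trans (h x)⟩
  invariant x y z := by simp [lie_eq_zero]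

variable {ε}

/-- A matrix that is antisymmetric with respect to `diag(ε)`, as an antisymmetric derivation. -/
def antisymmDerivation (M : Matrix ι ι ℝ)
    (hM : ∀ i j, ((ε i : ℤ) : ℝ) * M i j = -(((ε j : ℤ) : ℝ) * M j i)) :
    AntisymmDerivation (scalarProduct ε) where
  der :=
    { toLinearMap := (Matrix.mulVecLin M : (ι → ℝ) →ₗ[ℝ] (ι → ℝ))
      leibniz' := fun x y => by
        rw [lie_eq_zero, lie_eq_zero, lie_eq_zero, sub_zero]
        exact map_zero (Matrix.mulVecLin M) }
  antisymm x y := by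
    change ∑ i, ((ε i : ℤ) : ℝ) * (∑ j, M i j * x j) * y i
      = -∑ i, ((ε i : ℤ) : ℝ) * x i * (∑ j, M i j * y j)
    simp only [Finset.mul_sum, Finset.sum_mul]
    rw [Finset.sum_comm, ← Finset.sum_neg_distrib]
    refine Finset.sum_congr rfl fun i _ => ?_
    rw [← Finset.sum_neg_distrib]
    refine Finset.sum_congr rfl fun j _ => ?_
    linear_combination (x i * y j) * hM j i

end PseudoEuclidean

/-- The metric Lie algebra given by the double extension of the abelian metric Lie algebra
`(ℝ^ι, diag(ε))` by `ℝ` defined by the antisymmetric matrix `M`. If `ε` has `p` entries `-1` and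
`q` entries `1`, this is the algebra denoted by `M(p, q)`. -/
def abelianExtension {ι : Type*} [Fintype ι] (ε : ι → ℤˣ) (M : Matrix ι ι ℝ)
    (hM : ∀ i j, ((ε i : ℤ) : ℝ) * M i j = -(((ε j : ℤ) : ℝ) * M j i)) :
    ScalarProduct (DoubleExtension (PseudoEuclidean.antisymmDerivation M hM)) :=
  DoubleExtension.scalarProduct (PseudoEuclidean.antisymmDerivation M hM)

/-! ### The matrices of the classification -/

/-- `A_λ`: block diagonal with the blocks `Λ_r`. -/
def matA {l : ℕ} (lam : Fin l → ℝ) : Matrix (Fin 2 × Fin l) (Fin 2 × Fin l) ℝ :=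
  Matrix.blockDiagonal fun r => !![0, -lam r; lam r, 0]

def matL2 : Matrix (Fin 2) (Fin 2) ℝ := !![0, 1; 1, 0]

def matL3 : Matrix (Fin 3) (Fin 3) ℝ := !![0, 1, 0; 1, 0, 1; 0, -1, 0]

def matL2lam {l : ℕ} (lam : Fin l → ℝ) :
    Matrix (Fin 2 ⊕ (Fin 2 × Fin l)) (Fin 2 ⊕ (Fin 2 × Fin l)) ℝ :=
  Matrix.fromBlocks matL2 0 0 (matA lam)

def matL3lam {l : ℕ} (lam : Fin l → ℝ) :
    Matrix (Fin 3 ⊕ (Fin 2 × Fin l)) (Fin 3 ⊕ (Fin 2 × Fin l)) ℝ :=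
  Matrix.fromBlocks matL3 0 0 (matA lam)

/-- The signs of a Lorentzian scalar product `diag(-1, 1, …, 1)` on `ℝ^2` and `ℝ^3`. -/
def eps2 : Fin 2 → ℤˣ := ![-1, 1]

def eps3 : Fin 3 → ℤˣ := ![-1, 1, 1]

/-- Extension of a sign vector by plus signs. -/
def epsExt {m : ℕ} (ε : Fin m → ℤˣ) (l : ℕ) : Fin m ⊕ (Fin 2 × Fin l) → ℤˣ :=
  Sum.elim ε fun _ => 1

theorem matA_antisymm {l : ℕ} (lam : Fin l → ℝ) (i j : Fin 2 × Fin l) :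
    matA lam i j = -matA lam j i := by
  obtain ⟨i, r⟩ := i
  obtain ⟨j, s⟩ := j
  simp only [matA, Matrix.blockDiagonal_apply]
  by_cases h : r = s
  · subst h
    fin_cases i <;> fin_cases j <;> simp
  · simp [h, Ne.symm h]

theorem matL2_antisymm (i j : Fin 2) :
    ((eps2 i : ℤ) : ℝ) * matL2 i j = -(((eps2 j : ℤ) : ℝ) * matL2 j i) := by
  fin_cases i <;> fin_cases j <;> simp [eps2, matL2]

theorem matL3_antisymm (i j : Fin 3) :
    ((eps3 i : ℤ) : ℝ) * matL3 i j = -(((eps3 j : ℤ) : ℝ) * matL3 j i) := by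
  fin_cases i <;> fin_cases j <;> simp [eps3, matL3]

theorem fromBlocks_antisymm {m l : ℕ} {ε : Fin m → ℤˣ} {M : Matrix (Fin m) (Fin m) ℝ}
    (hM : ∀ i j, ((ε i : ℤ) : ℝ) * M i j = -(((ε j : ℤ) : ℝ) * M j i)) (lam : Fin l → ℝ)
    (i j : Fin m ⊕ (Fin 2 × Fin l)) :
    ((epsExt ε l i : ℤ) : ℝ) * Matrix.fromBlocks M 0 0 (matA lam) i j
      = -(((epsExt ε l j : ℤ) : ℝ) * Matrix.fromBlocks M 0 0 (matA lam) j i) := by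
  rcases i with i | i <;> rcases j with j | j
  · simpa [epsExt] using hM i j
  · simp
  · simp
  · simpa [epsExt] using matA_antisymm lam i j

/-- The metric Lie algebra `L_2(1, 1)`. -/
def algL2 := abelianExtension eps2 matL2 matL2_antisymm

/-- The metric Lie algebra `L_3(1, 2)`. -/
def algL3 := abelianExtension eps3 matL3 matL3_antisymm

/-- The metric Lie algebra `L_{2,λ}(1, 1 + 2l)`. -/
def algL2lam {l : ℕ} (lam : Fin l → ℝ) :=
  abelianExtension (epsExt eps2 l) (matL2lam lam) (fromBlocks_antisymm matL2_antisymm lam)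

/-- The metric Lie algebra `L_{3,λ}(1, 2 + 2l)`. -/
def algL3lam {l : ℕ} (lam : Fin l → ℝ) :=
  abelianExtension (epsExt eps3 l) (matL3lam lam) (fromBlocks_antisymm matL3_antisymm lam)

/-- The metric Lie algebra `(𝔡, Φ)`, of dimension `n`, is isomorphic to `L_2(1, 1)` and `n = 4`, to
`L_3(1, 2)` and `n = 5`, to some `L_{2,λ}(1, n - 3)` and `n > 5` is even, or to some
`L_{3,λ}(1, n - 3)` and `n > 5` is odd, where `λ = (λ_1, …, λ_l)` with `0 < λ_1 ≤ … ≤ λ_l`. -/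
def IsListed {𝔡 : Type*} [LieRing 𝔡] [LieAlgebra ℝ 𝔡] (Φ : ScalarProduct 𝔡) (n : ℕ) : Prop :=
  (n = 4 ∧ IsIsomorphic Φ algL2) ∨
  (n = 5 ∧ IsIsomorphic Φ algL3) ∨
  (5 < n ∧ Even n ∧ ∃ (l : ℕ) (lam : Fin l → ℝ), n - 3 = 1 + 2 * l ∧ (∀ r, 0 < lam r) ∧
    Monotone lam ∧ IsIsomorphic Φ (algL2lam lam)) ∨
  (5 < n ∧ Odd n ∧ ∃ (l : ℕ) (lam : Fin l → ℝ), n - 3 = 2 + 2 * l ∧ (∀ r, 0 < lam r) ∧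
    Monotone lam ∧ IsIsomorphic Φ (algL3lam lam))

end MetricLie

/-!
The proof reduces both hypotheses to one condition: there is a non-zero central vector `α`,
necessarily null because of indecomposability, such that `α^⊥` is abelian modulo `α`.

For a double extension of an abelian algebra this is immediate. If the centre is the line `ℝα`, the
form induced on `α^⊥ / α` has index one (`isSemiLorentzian_orthogonal`). Let `N` be the radical of
the Killing form restricted to `α^⊥`. All arguments take place in the given algebra, so that the
quotient `α^⊥ / α` is never formed.

* `N` is non-degenerate modulo `α` (`killingRadical_nondegenerate`): a further null vector of
  `N ∩ N^⊥` either is central or is an eigenvector of an outer derivation `ad H` for an eigenvalue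
  `c ≠ 0`, and then the eigenvector for `-c` lies in `N` as well, a contradiction.
* The Killing form is therefore zero on `α^⊥` (`killingForm_eq_zero_of_nondegenerate`): on `N^⊥`
  modulo `α` it is non-degenerate, `ad H` acts there as an inner derivation, and `N^⊥` would split
  off.
* A negative vector `x` of `α^⊥` satisfies `tr (ad x)² ≤ 0`, and equality forces `[x, α^⊥] ⊆ ℝα`.
  As negative vectors span, `α^⊥` is abelian modulo `α` (`exists_lie_eq_smul_of_killingForm`).

Under the common condition choose a null vector `H` with `⟨α, H⟩ = 1`. The algebra is the double
extension of the Lorentzian space `V = {α, H}^⊥` by `T = ad H` (`isIsomorphic_abelianExtension`).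
Vectors in the kernel of `T` are central, hence null. An antisymmetric operator with this property
has one of the two normal forms up to a scalar (`exists_isFrame_of_semiLorentzian`): if it is
invertible then it has a real eigenvalue, which gives the block `L₂`, and otherwise a null vector of
the kernel begins a Jordan chain of length three, which gives `L₃`. On the positive definite
orthogonal complement the operator is invertible and splits into rotation blocks
(`exists_isFrame_of_posDef`). The scalar is absorbed by rescaling `H` and `α`.
-/

namespace MetricLie

open LinearMap (BilinForm)

/-! ### Frames and the normal form on definite spaces -/

section Forms

variable {X : Type*} [AddCommGroup X] [Module ℝ X]

/-- Orthonormal vectors `b i` of signs `ε i` in a subspace `W`, which span `W` in the sense that no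
non-zero vector of `W` is orthogonal to all of them, and on which `T` acts by the matrix `M`. -/
structure IsFrame (B : BilinForm ℝ X) (T : X →ₗ[ℝ] X) (W : Submodule ℝ X) {ι : Type*} [Fintype ι]
    [DecidableEq ι] (ε : ι → ℤˣ) (M : Matrix ι ι ℝ) (b : ι → X) : Prop where
  mem : ∀ i, b i ∈ W
  orthonormal : ∀ i j, B (b i) (b j) = if i = j then ((ε i : ℤ) : ℝ) else 0
  map : ∀ j, T (b j) = ∑ i, M i j • b i
  complete : ∀ x ∈ W, (∀ i, B x (b i) = 0) → x = 0

/-- The spectral theorem for the inner product space defined by `B`. -/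
theorem exists_eigenvector_of_posDef [FiniteDimensional ℝ X] [Nontrivial X] (B : BilinForm ℝ X)
    (hB : B.IsSymm) (hpos : ∀ x, x ≠ 0 → 0 < B x x) (S : X →ₗ[ℝ] X)
    (hS : ∀ x y, B (S x) y = B x (S y)) : ∃ (μ : ℝ) (v : X), v ≠ 0 ∧ S v = μ • v := by
  let core : InnerProductSpace.Core ℝ X :=
    { inner := fun x y => B x y
      conj_inner_symm := fun x y => by simpa using hB.eq y x
      re_inner_nonneg := fun x => by
        rcases eq_or_ne x 0 with rfl | hx
        · simp
        · simpa using (hpos x hx).le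
      add_left := fun x y z => by simp
      smul_left := fun x y c => by simp
      definite := fun x hx => by
        by_contra h
        exact (hpos x h).ne' hx }
  let _ : NormedAddCommGroup X := core.toNormedAddCommGroup
  let _ : InnerProductSpace ℝ X := InnerProductSpace.ofCore core.toCore
  have hsymm : S.IsSymmetric := fun x y => hS x y
  obtain ⟨v, hv⟩ := hsymm.hasEigenvalue_iSup_of_finiteDimensional.exists_hasEigenvector
  exact ⟨_, v, hv.2, Module.End.mem_eigenspace_iff.mp hv.1⟩

variable {B : BilinForm ℝ X} {T : X →ₗ[ℝ] X}

/-- The vectors `u r`, `v r` are the two halves of the real normal form of an invertible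
antisymmetric operator. Each plane is spanned by an eigenvector `u` of the symmetric operator `T²`
and by `T u`; its orthogonal complement is again `T`-invariant. -/
theorem exists_rotation_planes [FiniteDimensional ℝ X] (hB : B.IsSymm)
    (hT : ∀ x y, B (T x) y = -B x (T y))
    (W : Submodule ℝ X) (hpos : ∀ x ∈ W, x ≠ 0 → 0 < B x x) (hTW : ∀ x ∈ W, T x ∈ W)
    (hinj : ∀ x ∈ W, T x = 0 → x = 0) :
    ∃ (l : ℕ) (lam : Fin l → ℝ) (u v : Fin l → X),
      (∀ r, 0 < lam r ∧ u r ∈ W ∧ v r ∈ W ∧ T (u r) = lam r • v r ∧ T (v r) = -lam r • u r) ∧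
      (∀ r s, B (u r) (u s) = if r = s then 1 else 0) ∧
      (∀ r s, B (v r) (v s) = if r = s then 1 else 0) ∧
      (∀ r s, B (u r) (v s) = 0) ∧
      ∀ x ∈ W, (∀ r, B x (u r) = 0) → (∀ r, B x (v r) = 0) → x = 0 := by
  obtain ⟨d, hd⟩ : ∃ d, Module.finrank ℝ W = d := ⟨_, rfl⟩
  induction d using Nat.strong_induction_on generalizing W with
  | _ d ih =>
  rcases eq_or_ne W ⊥ with hW | hW
  · refine ⟨0, fun _ => 0, fun _ => 0, fun _ => 0, fun r => r.elim0, fun r => r.elim0,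
      fun r => r.elim0, fun r => r.elim0, fun x hx _ _ => ?_⟩
    rwa [hW, Submodule.mem_bot] at hx
  have : Nontrivial W := (Submodule.nontrivial_iff_ne_bot).mpr hW
  obtain ⟨μ, ⟨w, hwW⟩, hw0, hw⟩ := exists_eigenvector_of_posDef (B.restrict W)
    ⟨fun x y => hB.eq x y⟩ (fun x hx => hpos x x.2 fun h => hx (Subtype.ext h))
    ((T.restrict hTW) ∘ₗ (T.restrict hTW)) (fun x y => by
      change B (T (T x)) y = B x (T (T y))
      rw [hT, hT, neg_neg])
  have hw0' : w ≠ 0 := fun h => hw0 (Subtype.ext h)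
  have hTw : T (T w) = μ • w := congrArg Subtype.val hw
  have hwp := hpos w hwW hw0'
  have hTwp := hpos (T w) (hTW w hwW) fun h => hw0' (hinj w hwW h)
  have hμ : B (T w) (T w) = -μ * B w w := by rw [hT, hTw, map_smul, smul_eq_mul, neg_mul]
  have hμ0 : 0 < -μ := by
    rw [hμ] at hTwp
    exact pos_of_mul_pos_left hTwp hwp.le
  -- On the plane spanned by `w` and `T w`, the operator `T` is `c` times a quarter turn.
  set c := Real.sqrt (-μ) with hc
  have hc0 : 0 < c := Real.sqrt_pos.mpr hμ0
  have hcc : c * c = -μ := Real.mul_self_sqrt hμ0.le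
  set a := Real.sqrt (B w w) with ha
  have ha0 : 0 < a := Real.sqrt_pos.mpr hwp
  have haa : a * a = B w w := Real.mul_self_sqrt hwp.le
  set u₀ := a⁻¹ • w with hu₀
  set v₀ := (c⁻¹ * a⁻¹) • T w with hv₀
  have hu₀W : u₀ ∈ W := W.smul_mem _ hwW
  have hv₀W : v₀ ∈ W := W.smul_mem _ (hTW w hwW)
  have hTu₀ : T u₀ = c • v₀ := by
    rw [hu₀, hv₀, map_smul, smul_smul]
    congr 1
    field_simp
  have hTv₀ : T v₀ = -c • u₀ := by
    rw [hu₀, hv₀, map_smul, hTw, smul_smul, smul_smul]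
    congr 1
    rw [show μ = -(c * c) by rw [hcc, neg_neg]]
    field_simp
  have huu : B u₀ u₀ = 1 := by
    simp only [hu₀, map_smul, LinearMap.smul_apply, smul_eq_mul, ← haa]
    field_simp
  have hvv : B v₀ v₀ = 1 := by
    simp only [hv₀, map_smul, LinearMap.smul_apply, smul_eq_mul, hμ, ← haa, ← hcc]
    field_simp
  have huv : B u₀ v₀ = 0 := by
    have h1 := hT u₀ u₀
    rw [hB.eq u₀ (T u₀)] at h1
    have h2 : B (T u₀) u₀ = 0 := by linarith
    rw [hTu₀, LinearMap.map_smul₂, smul_eq_mul] at h2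
    rw [← hB.eq]
    exact (mul_eq_zero.mp h2).resolve_left hc0.ne'
  let W' : Submodule ℝ X := W ⊓ (LinearMap.ker (B.flip u₀) ⊓ LinearMap.ker (B.flip v₀))
  have hmem (x : X) : x ∈ W' ↔ x ∈ W ∧ B x u₀ = 0 ∧ B x v₀ = 0 := by simp [W']
  have hlt : W' < W := by
    refine lt_of_le_of_ne inf_le_left fun h => ?_
    have := ((hmem u₀).mp (h ▸ hu₀W)).2.1
    rw [huu] at this
    exact one_ne_zero this
  obtain ⟨l, lam, u, v, h1, h2, h3, h4, h5⟩ := ih _ (hd ▸ Submodule.finrank_lt_finrank_of_lt hlt)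
    W' (fun x hx => hpos x ((hmem x).mp hx).1) (fun x hx => by
      obtain ⟨hx1, hx2, hx3⟩ := (hmem x).mp hx
      refine (hmem _).mpr ⟨hTW x hx1, ?_, ?_⟩
      · rw [hT, hTu₀, map_smul, hx3, smul_zero, neg_zero]
      · rw [hT, hTv₀, map_smul, hx2, smul_zero, neg_zero])
    (fun x hx => hinj x ((hmem x).mp hx).1) rfl
  have hu (r) := (hmem _).mp (h1 r).2.1
  have hv (r) := (hmem _).mp (h1 r).2.2.1
  have hu1 (r) : B u₀ (u r) = 0 := by rw [← (hu r).2.1]; exact hB.eq _ _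
  have hv1 (r) : B u₀ (v r) = 0 := by rw [← (hv r).2.1]; exact hB.eq _ _
  have hv2 (r) : B v₀ (v r) = 0 := by rw [← (hv r).2.2]; exact hB.eq _ _
  refine ⟨l + 1, Fin.cons c lam, Fin.cons u₀ u, Fin.cons v₀ v, ?_, ?_, ?_, ?_, ?_⟩
  · refine Fin.cases ⟨hc0, hu₀W, hv₀W, hTu₀, hTv₀⟩ fun r => ?_
    exact ⟨(h1 r).1, (hu r).1, (hv r).1, (h1 r).2.2.2.1, (h1 r).2.2.2.2⟩
  · refine Fin.cases (Fin.cases ?_ fun s => ?_) fun r => Fin.cases ?_ fun s => ?_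
    · simpa using huu
    · simpa [(Fin.succ_ne_zero s).symm] using hu1 s
    · simpa using (hu r).2.1
    · simpa using h2 r s
  · refine Fin.cases (Fin.cases ?_ fun s => ?_) fun r => Fin.cases ?_ fun s => ?_
    · simpa using hvv
    · simpa [(Fin.succ_ne_zero s).symm] using hv2 s
    · simpa using (hv r).2.2
    · simpa using h3 r s
  · refine Fin.cases (Fin.cases ?_ fun s => ?_) fun r => Fin.cases ?_ fun s => ?_
    · simpa using huv
    · simpa using hv1 s
    · simpa using (hu r).2.2
    · simpa using h4 r s
  · intro x hx hxu hxv
    exact h5 x ((hmem x).mpr ⟨hx, hxu 0, hxv 0⟩) (fun r => hxu r.succ) fun r => hxv r.succ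

/-- The real normal form of an invertible antisymmetric operator on a Euclidean space. -/
theorem exists_isFrame_of_posDef [FiniteDimensional ℝ X] (hB : B.IsSymm)
    (hT : ∀ x y, B (T x) y = -B x (T y))
    (W : Submodule ℝ X) (hpos : ∀ x ∈ W, x ≠ 0 → 0 < B x x) (hTW : ∀ x ∈ W, T x ∈ W)
    (hinj : ∀ x ∈ W, T x = 0 → x = 0) :
    ∃ (l : ℕ) (lam : Fin l → ℝ) (b : Fin 2 × Fin l → X),
      (∀ r, 0 < lam r) ∧ Monotone lam ∧ IsFrame B T W (fun _ => 1) (matA lam) b := by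
  obtain ⟨l, lam, u, v, h1, h2, h3, h4, h5⟩ := exists_rotation_planes hB hT W hpos hTW hinj
  set σ := Tuple.sort lam
  refine ⟨l, lam ∘ σ, fun i => ![u (σ i.2), v (σ i.2)] i.1, fun r => (h1 _).1,
    Tuple.monotone_sort lam, ?_, ?_, ?_, ?_⟩
  · rintro ⟨i, r⟩
    fin_cases i
    · exact (h1 _).2.1
    · exact (h1 _).2.2.1
  · rintro ⟨i, r⟩ ⟨j, s⟩
    fin_cases i <;> fin_cases j
    · simp [h2]
    · simp [h4]
    · simpa using (hB.eq _ _).trans (h4 (σ s) (σ r))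
    · simp [h3]
  · rintro ⟨j, s⟩
    rw [Fintype.sum_prod_type]
    fin_cases j
    · simp [matA, Matrix.blockDiagonal_apply, ite_smul, (h1 _).2.2.2.1]
    · simp [matA, Matrix.blockDiagonal_apply, ite_smul, (h1 _).2.2.2.2]
  · intro x hx h
    refine h5 x hx (fun r => ?_) fun r => ?_
    · simpa using h (0, σ.symm r)
    · simpa using h (1, σ.symm r)

/-- Orthonormal vectors spanning a `T`-invariant subspace, together with a frame of the orthogonal
complement of that subspace, form a frame. -/
theorem IsFrame.sumElim (hB : B.IsSymm) {W W' : Submodule ℝ X} {m l : ℕ} {ε : Fin m → ℤˣ}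
    {M : Matrix (Fin m) (Fin m) ℝ} {b : Fin m → X} {lam : Fin l → ℝ} {b' : Fin 2 × Fin l → X}
    (hmem : ∀ i, b i ∈ W) (horth : ∀ i j, B (b i) (b j) = if i = j then ((ε i : ℤ) : ℝ) else 0)
    (hmap : ∀ j, T (b j) = ∑ i, M i j • b i)
    (hW' : ∀ x, x ∈ W' ↔ x ∈ W ∧ ∀ i, B x (b i) = 0)
    (h' : IsFrame B T W' (fun _ => 1) (matA lam) b') :
    IsFrame B T W (epsExt ε l) (Matrix.fromBlocks M 0 0 (matA lam)) (Sum.elim b b') where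
  mem := by
    rintro (i | i)
    · exact hmem i
    · exact ((hW' _).mp (h'.mem i)).1
  orthonormal := by
    rintro (i | i) (j | j)
    · simpa [epsExt] using horth i j
    · simpa using (hB.eq _ _).symm.trans (((hW' _).mp (h'.mem j)).2 i)
    · simpa using ((hW' _).mp (h'.mem i)).2 j
    · simpa [epsExt] using h'.orthonormal i j
  map := by
    rintro (j | j)
    · simpa using hmap j
    · simpa using h'.map j
  complete x hx hxb :=
    h'.complete x ((hW' x).mpr ⟨hx, fun i => hxb (Sum.inl i)⟩) fun i => hxb (Sum.inr i)

theorem IsFrame.comp_inl {W : Submodule ℝ X} {m : ℕ} {ε : Fin m → ℤˣ}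
    {M : Matrix (Fin m) (Fin m) ℝ} {lam : Fin 0 → ℝ} {b : Fin m ⊕ (Fin 2 × Fin 0) → X}
    (h : IsFrame B T W (epsExt ε 0) (Matrix.fromBlocks M 0 0 (matA lam)) b) :
    IsFrame B T W ε M (b ∘ Sum.inl) where
  mem i := h.mem _
  orthonormal i j := by simpa [epsExt] using h.orthonormal (Sum.inl i) (Sum.inl j)
  map j := by simpa using h.map (Sum.inl j)
  complete x hx hxb := h.complete x hx (by
    rintro (i | i)
    · exact hxb i
    · exact i.2.elim0)

end Forms

/-! ### Antisymmetric operators on Lorentzian spaces -/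

section Skew

variable {ι : Type*} [Fintype ι] [DecidableEq ι]

/-- The determinant does not vanish on the segment from `S` to the identity matrix, because an
antisymmetric matrix has no non-zero real eigenvalue. -/
theorem det_pos_of_transpose_eq_neg (S : Matrix ι ι ℝ) (hS : S.transpose = -S) (h0 : S.det ≠ 0) :
    0 < S.det := by
  by_contra hneg
  let g : ℝ → ℝ := fun t => ((1 - t) • S + t • (1 : Matrix ι ι ℝ)).det
  have hg : Continuous g := by
    apply Continuous.matrix_det
    fun_prop
  have hg0 : g 0 ≤ 0 := by simpa [g] using not_lt.mp hneg
  have hg1 : 0 ≤ g 1 := by simp [g]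
  obtain ⟨t, ht, hgt⟩ := intermediate_value_Icc zero_le_one hg.continuousOn ⟨hg0, hg1⟩
  rcases ht.1.eq_or_lt with rfl | htpos
  · exact h0 (by simpa [g] using hgt)
  obtain ⟨x, hx, hmx⟩ := Matrix.exists_mulVec_eq_zero_iff.mpr hgt
  have hSx : x ⬝ᵥ S.mulVec x = 0 := by
    have : x ⬝ᵥ S.mulVec x = -(x ⬝ᵥ S.mulVec x) := by
      conv_lhs => rw [Matrix.dotProduct_mulVec, ← Matrix.mulVec_transpose, hS, Matrix.neg_mulVec,
        neg_dotProduct, dotProduct_comm]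
    linarith
  have h1 := congrArg (fun y => x ⬝ᵥ y) hmx
  simp only [Matrix.add_mulVec, Matrix.smul_mulVec, Matrix.one_mulVec, dotProduct_add,
    dotProduct_smul, hSx, mul_zero, zero_add, dotProduct_zero, smul_eq_mul] at h1
  exact hx (dotProduct_self_eq_zero.mp ((mul_eq_zero.mp h1).resolve_left htpos.ne'))

end Skew

section Forms

variable {X : Type*} [AddCommGroup X] [Module ℝ X]

/-- The form `B` on `E` has index one modulo its radical: there are vectors of negative length,
and the orthogonal complement in `E` of such a vector is positive semidefinite, all its null vectors
lying in the radical of `E`. -/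
structure IsSemiLorentzian (B : BilinForm ℝ X) (E : Submodule ℝ X) : Prop where
  exists_neg : ∃ e ∈ E, B e e < 0
  nonneg : ∀ e ∈ E, B e e < 0 → ∀ y ∈ E, B e y = 0 → 0 ≤ B y y
  radical : ∀ e ∈ E, B e e < 0 → ∀ y ∈ E, B e y = 0 → B y y = 0 → ∀ z ∈ E, B y z = 0

variable {B : BilinForm ℝ X} {T : X →ₗ[ℝ] X}

/-- The orthogonal complement of a null vector `γ` is positive semidefinite, and its null vectors
are multiples of `γ` modulo the radical. -/
theorem IsSemiLorentzian.nonneg_of_null {E : Submodule ℝ X} (h : IsSemiLorentzian B E)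
    (hB : B.IsSymm) {γ u : X} (hγ : γ ∈ E) (hγγ : B γ γ = 0) (hγr : ∃ z ∈ E, B γ z ≠ 0)
    (hu : u ∈ E) (hγu : B γ u = 0) :
    0 ≤ B u u ∧ (B u u = 0 → ∃ t : ℝ, ∀ z ∈ E, B (u - t • γ) z = 0) := by
  obtain ⟨e, he, hee⟩ := h.exists_neg
  have heγ : B e γ ≠ 0 := fun h0 => by
    obtain ⟨z, hz, hγz⟩ := hγr
    exact hγz (h.radical e he hee γ hγ h0 hγγ z hz)
  set t := B e u / B e γ with ht
  have hmem : u - t • γ ∈ E := E.sub_mem hu (E.smul_mem t hγ)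
  have horth : B e (u - t • γ) = 0 := by
    rw [map_sub, map_smul, smul_eq_mul, ht, div_mul_cancel₀ _ heγ, sub_self]
  have huγ : B u γ = 0 := (hB.eq u γ).trans hγu
  have hnorm : B (u - t • γ) (u - t • γ) = B u u := by
    simp [hγγ, hγu, huγ]
  exact ⟨hnorm ▸ h.nonneg e he hee _ hmem horth,
    fun h0 => ⟨t, h.radical e he hee _ hmem horth (hnorm.trans h0)⟩⟩

theorem form_self_map_eq_zero (hB : B.IsSymm) (hT : ∀ x y, B (T x) y = -B x (T y)) (x : X) :
    B (T x) x = 0 := by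
  have h1 := hT x x
  have h2 := hB.eq x (T x)
  linarith

theorem null_of_eigenvector (hB : B.IsSymm) (hT : ∀ x y, B (T x) y = -B x (T y)) {c : ℝ}
    (hc : c ≠ 0) {v : X} (hv : T v = c • v) : B v v = 0 := by
  have h := form_self_map_eq_zero hB hT v
  rw [hv, LinearMap.map_smul₂, smul_eq_mul] at h
  exact (mul_eq_zero.mp h).resolve_left hc

variable [FiniteDimensional ℝ X]

/-- The image of `T + c` is orthogonal to the eigenvector `v`, so that `T + c` is not invertible. -/
theorem exists_eigenvector_neg (hnd : B.Nondegenerate)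
    (hT : ∀ x y, B (T x) y = -B x (T y)) {c : ℝ} {v : X} (hv0 : v ≠ 0) (hv : T v = c • v) :
    ∃ w, w ≠ 0 ∧ T w = -c • w := by
  by_contra! hcon
  have hinj : Function.Injective (T + c • (LinearMap.id : X →ₗ[ℝ] X)) := by
    rw [← LinearMap.ker_eq_bot, LinearMap.ker_eq_bot']
    intro w hw
    by_contra hw0
    refine hcon w hw0 ?_
    rw [neg_smul]
    exact eq_neg_of_add_eq_zero_left hw
  refine hv0 (hnd.1 v fun z => ?_)
  obtain ⟨y, rfl⟩ := LinearMap.surjective_of_injective hinj z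
  have h := hT v y
  rw [hv, LinearMap.map_smul₂, smul_eq_mul] at h
  simp only [LinearMap.add_apply, LinearMap.smul_apply, LinearMap.id_apply, map_add, map_smul,
    smul_eq_mul]
  linarith

/-- The image of an antisymmetric operator is the orthogonal complement of its kernel. -/
theorem exists_map_eq_of_orthogonal_ker (hB : B.IsSymm) (hnd : B.Nondegenerate)
    (hT : ∀ x y, B (T x) y = -B x (T y)) {y : X} (hy : ∀ k, T k = 0 → B k y = 0) :
    ∃ x, T x = y := by
  have h := LinearMap.BilinForm.orthogonal_orthogonal hnd hB.isRefl (LinearMap.range T)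
  suffices y ∈ LinearMap.range T from this
  rw [← h, LinearMap.BilinForm.mem_orthogonal_iff]
  intro k hk
  refine hy k (hnd.2 _ fun z => ?_)
  have h1 : B (T z) k = 0 := LinearMap.BilinForm.mem_orthogonal_iff.mp hk (T z) ⟨z, rfl⟩
  rw [hT] at h1
  exact neg_eq_zero.mp h1

/-- An invertible antisymmetric operator on a Lorentzian space has a non-zero real eigenvalue. In an
orthogonal basis let `S` be the matrix of the form `⟨T ·, ·⟩` and `D` that of the scalar product;
then `det S > 0 > det D`, so that the determinant vanishes somewhere between `S` and `D`. -/
theorem exists_real_eigenvector (hB : B.IsSymm) (hnd : B.Nondegenerate)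
    (hT : ∀ x y, B (T x) y = -B x (T y)) (h : IsSemiLorentzian B ⊤) (hinj : ∀ x, T x = 0 → x = 0) :
    ∃ (c : ℝ) (v : X), c ≠ 0 ∧ v ≠ 0 ∧ T v = c • v := by
  obtain ⟨v, hv⟩ := LinearMap.BilinForm.exists_orthogonal_basis ⟨hB.eq⟩
  have hvo : ∀ i j, i ≠ j → B (v i) (v j) = 0 := fun i j hij => hv hij
  have hsep (y : X) (hy : ∀ i, B y (v i) = 0) : y = 0 := by
    refine hnd.1 y fun z => ?_
    rw [← v.sum_repr z, map_sum]
    exact Finset.sum_eq_zero fun i _ => by rw [map_smul, hy, smul_zero]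
  have hd (i) : B (v i) (v i) ≠ 0 := fun h0 => v.ne_zero i (hsep _ fun j => by
    rcases eq_or_ne i j with rfl | hij
    · exact h0
    · exact hvo i j hij)
  have hvx (x : Fin (Module.finrank ℝ X) → ℝ) (i) :
      B (∑ j, x j • v j) (v i) = B (v i) (v i) * x i := by
    rw [map_sum, LinearMap.sum_apply, Finset.sum_eq_single i]
    · rw [LinearMap.map_smul₂, smul_eq_mul, mul_comm]
    · intro j _ hj
      rw [LinearMap.map_smul₂, hvo j i hj, smul_zero]
    · simp
  obtain ⟨i₀, hi₀⟩ : ∃ i, B (v i) (v i) < 0 := by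
    by_contra! hcon
    obtain ⟨e, -, he⟩ := h.exists_neg
    refine he.not_ge ?_
    rw [← v.sum_repr e, map_sum]
    refine Finset.sum_nonneg fun i _ => ?_
    rw [map_smul, hvx, smul_eq_mul]
    nlinarith [hcon i, mul_nonneg (hcon i) (mul_self_nonneg (v.repr e i))]
  let D : Matrix (Fin (Module.finrank ℝ X)) (Fin (Module.finrank ℝ X)) ℝ :=
    Matrix.diagonal fun i => B (v i) (v i)
  let S : Matrix (Fin (Module.finrank ℝ X)) (Fin (Module.finrank ℝ X)) ℝ :=
    Matrix.of fun i j => B (T (v j)) (v i)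
  have hDneg : D.det < 0 := by
    rw [Matrix.det_diagonal, ← Finset.mul_prod_erase _ _ (Finset.mem_univ i₀)]
    refine mul_neg_of_neg_of_pos hi₀ (Finset.prod_pos fun i hi => ?_)
    exact lt_of_le_of_ne (h.nonneg (v i₀) trivial hi₀ (v i) trivial
      (hvo _ _ (Finset.ne_of_mem_erase hi).symm)) (hd i).symm
  have hDx (x) (i) : D.mulVec x i = B (∑ j, x j • v j) (v i) := by
    rw [Matrix.mulVec_diagonal, hvx]
  have hSx (x) (i) : S.mulVec x i = B (T (∑ j, x j • v j)) (v i) := by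
    simp [S, Matrix.mulVec, dotProduct, mul_comm]
  have hx0 {x : Fin (Module.finrank ℝ X) → ℝ} (hx : ∑ j, x j • v j = 0) : x = 0 :=
    funext (Fintype.linearIndependent_iff.mp v.linearIndependent x hx)
  have hSpos : 0 < S.det := by
    refine det_pos_of_transpose_eq_neg S ?_ fun h0 => ?_
    · ext i j
      have := hB.eq (v i) (T (v j))
      simp [S, hT (v i), this]
    · obtain ⟨x, hx, hx'⟩ := Matrix.exists_mulVec_eq_zero_iff.mpr h0
      refine hx (hx0 (hinj _ (hsep _ fun i => ?_)))
      rw [← hSx, hx', Pi.zero_apply]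
  let g : ℝ → ℝ := fun t => ((1 - t) • S + t • D).det
  have hg : Continuous g := by
    apply Continuous.matrix_det
    fun_prop
  have hg0 : g 0 = S.det := by simp [g]
  have hg1 : g 1 = D.det := by simp [g]
  obtain ⟨t, ht, hgt⟩ := intermediate_value_Icc' zero_le_one hg.continuousOn
    ⟨hg1 ▸ hDneg.le, hg0 ▸ hSpos.le⟩
  have ht0 : t ≠ 0 := by rintro rfl; exact hSpos.ne' (hg0 ▸ hgt)
  have ht1 : 1 - t ≠ 0 := fun h1 => by
    obtain rfl : t = 1 := by linarith
    exact hDneg.ne (hg1 ▸ hgt)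
  obtain ⟨x, hx, hmx⟩ := Matrix.exists_mulVec_eq_zero_iff.mpr hgt
  have hX := hsep ((1 - t) • T (∑ j, x j • v j) + t • ∑ j, x j • v j) fun i => by
    have := congrFun hmx i
    simpa [Matrix.add_mulVec, Matrix.smul_mulVec, hSx, hDx] using this
  refine ⟨-((1 - t)⁻¹ * t), _, neg_ne_zero.mpr (mul_ne_zero (inv_ne_zero ht1) ht0),
    fun h0 => hx (hx0 h0), ?_⟩
  rw [neg_smul, mul_smul, ← smul_neg, ← eq_neg_of_add_eq_zero_left hX, inv_smul_smul₀ ht1]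

/-- Orthonormal vectors spanning a `T`-invariant subspace which contains a negative vector extend to
a frame, because the orthogonal complement is positive definite. -/
theorem exists_isFrame_extend (hB : B.IsSymm) (hT : ∀ x y, B (T x) y = -B x (T y))
    {V : Submodule ℝ X} (hTV : ∀ x ∈ V, T x ∈ V) (h : IsSemiLorentzian B V)
    (hnd : ∀ y ∈ V, (∀ z ∈ V, B y z = 0) → y = 0) (hker : ∀ x ∈ V, T x = 0 → B x x = 0)
    {m : ℕ} {ε : Fin m → ℤˣ} {M : Matrix (Fin m) (Fin m) ℝ} {b : Fin m → X}
    (hmem : ∀ i, b i ∈ V) (horth : ∀ i j, B (b i) (b j) = if i = j then ((ε i : ℤ) : ℝ) else 0)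
    (hmap : ∀ j, T (b j) = ∑ i, M i j • b i) (hneg : ∃ i, ε i = -1) :
    ∃ (l : ℕ) (lam : Fin l → ℝ) (b' : Fin m ⊕ (Fin 2 × Fin l) → X),
      (∀ r, 0 < lam r) ∧ Monotone lam ∧
      IsFrame B T V (epsExt ε l) (Matrix.fromBlocks M 0 0 (matA lam)) b' := by
  let W : Submodule ℝ X := V ⊓ ⨅ i, LinearMap.ker (B.flip (b i))
  have hW (x : X) : x ∈ W ↔ x ∈ V ∧ ∀ i, B x (b i) = 0 := by simp [W]
  obtain ⟨i₀, hi₀⟩ := hneg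
  have hb0 : B (b i₀) (b i₀) < 0 := by rw [horth, if_pos rfl, hi₀]; norm_num
  have hpos (x : X) (hx : x ∈ W) (hx0 : x ≠ 0) : 0 < B x x := by
    obtain ⟨hxV, hxb⟩ := (hW x).mp hx
    have hbx : B (b i₀) x = 0 := (hB.eq _ _).symm.trans (hxb i₀)
    refine lt_of_le_of_ne (h.nonneg _ (hmem i₀) hb0 x hxV hbx) fun h0 => hx0 ?_
    exact hnd x hxV (h.radical _ (hmem i₀) hb0 x hxV hbx h0.symm)
  obtain ⟨l, lam, b', h1, h2, h3⟩ := exists_isFrame_of_posDef hB hT W hpos (fun x hx => by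
    obtain ⟨hxV, hxb⟩ := (hW x).mp hx
    refine (hW _).mpr ⟨hTV x hxV, fun i => ?_⟩
    rw [hT, hmap, map_sum, neg_eq_zero]
    exact Finset.sum_eq_zero fun j _ => by rw [map_smul, hxb, smul_zero]) fun x hx hTx => by
    by_contra hx0
    exact (hpos x hx hx0).ne' (hker x ((hW x).mp hx).1 hTx)
  exact ⟨l, lam, _, h1, h2, h3.sumElim hB hmem horth hmap hW⟩

/-- The normal form of an antisymmetric operator `T` on a Lorentzian space, up to rescaling, if all
vectors in the kernel of `T` are null. If `T` is injective then it has eigenvectors `β`, `γ` for two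
real eigenvalues `c`, `-c`, which span a Lorentzian plane. Otherwise a vector `β` of the kernel is
orthogonal to the kernel, hence of the form `T w`, and again `w = T η`; then `η`, `w`, `β` span a
Lorentzian space of dimension three. -/
theorem exists_isFrame_of_semiLorentzian (hB : B.IsSymm) (hT : ∀ x y, B (T x) y = -B x (T y))
    {V : Submodule ℝ X} (hTV : ∀ x ∈ V, T x ∈ V) (h : IsSemiLorentzian B V)
    (hnd : ∀ y ∈ V, (∀ z ∈ V, B y z = 0) → y = 0) (hker : ∀ x ∈ V, T x = 0 → B x x = 0) :
    ∃ c : ℝ, c ≠ 0 ∧ ∃ (l : ℕ) (lam : Fin l → ℝ), (∀ r, 0 < lam r) ∧ Monotone lam ∧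
      ((∃ b, IsFrame B (c • T) V (epsExt eps2 l) (matL2lam lam) b) ∨
        ∃ b, IsFrame B (c • T) V (epsExt eps3 l) (matL3lam lam) b) := by
  have hBV : (B.restrict V).IsSymm := ⟨fun x y => hB.eq x y⟩
  have hndV : (B.restrict V).Nondegenerate := by
    have h1 : ∀ y : V, (∀ z : V, B.restrict V y z = 0) → y = 0 := fun y hy =>
      Subtype.ext (hnd y y.2 fun z hz => hy ⟨z, hz⟩)
    exact ⟨h1, fun y hy => h1 y fun z => (hBV.eq y z).trans (hy z)⟩
  have hTV' (x y : V) : B.restrict V (T.restrict hTV x) y = -B.restrict V x (T.restrict hTV y) :=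
    hT x y
  have hex {β : X} (hβ : β ∈ V) (hβ0 : β ≠ 0) : ∃ z ∈ V, B β z ≠ 0 := by
    by_contra! hcon
    exact hβ0 (hnd β hβ hcon)
  by_cases hinj : ∀ x ∈ V, T x = 0 → x = 0
  · obtain ⟨c, ⟨β, hβ⟩, hc, hβ0, hTβ⟩ := exists_real_eigenvector hBV hndV hTV'
      ⟨by obtain ⟨e, he, hee⟩ := h.exists_neg; exact ⟨⟨e, he⟩, trivial, hee⟩,
        fun e _ hee y _ => h.nonneg e e.2 hee y y.2,
        fun e _ hee y _ hey hyy z _ => h.radical e e.2 hee y y.2 hey hyy z z.2⟩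
      fun x hx => Subtype.ext (hinj x x.2 (congrArg Subtype.val hx))
    obtain ⟨⟨γ, hγ⟩, hγ0, hTγ⟩ := exists_eigenvector_neg hndV hTV' hβ0 hTβ
    replace hβ0 : β ≠ 0 := fun h0 => hβ0 (Subtype.ext h0)
    replace hγ0 : γ ≠ 0 := fun h0 => hγ0 (Subtype.ext h0)
    replace hTβ : T β = c • β := congrArg Subtype.val hTβ
    replace hTγ : T γ = -c • γ := congrArg Subtype.val hTγ
    have hββ := null_of_eigenvector hB hT hc hTβ
    have hγγ := null_of_eigenvector hB hT (neg_ne_zero.mpr hc) hTγ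
    have hβγ : B β γ ≠ 0 := fun h0 => by
      obtain ⟨t, ht⟩ := (h.nonneg_of_null hB hβ hββ (hex hβ hβ0) hγ h0).2 hγγ
      have h1 := sub_eq_zero.mp (hnd _ (V.sub_mem hγ (V.smul_mem t hβ)) ht)
      have h2 : (2 * c) • γ = 0 := by
        have h3 : T γ = c • γ := by rw [h1, map_smul, hTβ, smul_comm]
        rw [hTγ] at h3
        rw [two_mul, add_smul]
        nth_rewrite 1 [← h3]
        rw [neg_smul, neg_add_cancel]
      exact hγ0 ((smul_eq_zero.mp h2).resolve_left (mul_ne_zero two_ne_zero hc))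
    have hγβ : B γ β = B β γ := hB.eq γ β
    -- The factor `k` makes the product of `β` and `k • γ` equal to `-2`.
    obtain ⟨k, hk⟩ : ∃ k : ℝ, k * B β γ = -2 := ⟨-2 / B β γ, div_mul_cancel₀ _ hβγ⟩
    have hcT (x y : X) : B ((c⁻¹ • T) x) y = -B x ((c⁻¹ • T) y) := by simp [hT]
    have hTβ' : (c⁻¹ • T) β = β := by rw [LinearMap.smul_apply, hTβ, inv_smul_smul₀ hc]
    have hTγ' : (c⁻¹ • T) γ = -γ := by
      rw [LinearMap.smul_apply, hTγ, neg_smul, smul_neg, inv_smul_smul₀ hc]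
    obtain ⟨l, lam, b, h1, h2, h3⟩ := exists_isFrame_extend hB hcT
      (fun x hx => V.smul_mem _ (hTV x hx)) h hnd
      (fun x hx hx0 => hker x hx ((smul_eq_zero.mp hx0).resolve_left (inv_ne_zero hc)))
      (ε := eps2) (M := matL2)
      (b := ![(1 / 2 : ℝ) • (β + k • γ), (1 / 2 : ℝ) • (β - k • γ)])
      (by
        intro i
        fin_cases i
        · exact V.smul_mem _ (V.add_mem hβ (V.smul_mem _ hγ))
        · exact V.smul_mem _ (V.sub_mem hβ (V.smul_mem _ hγ)))
      (by
        intro i j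
        fin_cases i <;> fin_cases j <;> simp [eps2, hββ, hγγ, hγβ] <;> linarith)
      (by
        intro j
        fin_cases j <;>
          simp only [Fin.zero_eta, Fin.mk_one, Matrix.cons_val_zero, Matrix.cons_val_one, map_smul,
            map_add, map_sub, hTβ', hTγ', matL2, Fin.sum_univ_two, Matrix.of_apply,
            Matrix.cons_val', Matrix.cons_val_fin_one] <;> module)
      ⟨0, rfl⟩
    exact ⟨c⁻¹, inv_ne_zero hc, l, lam, h1, h2, Or.inl ⟨b, h3⟩⟩
  · push Not at hinj
    obtain ⟨β₀, hβ₀, hTβ₀, hβ₀0⟩ := hinj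
    have hβ₀β₀ := hker β₀ hβ₀ hTβ₀
    have hrange {y : X} (hy : y ∈ V) (hyk : ∀ k ∈ V, T k = 0 → B k y = 0) : ∃ x ∈ V, T x = y := by
      obtain ⟨x, hx⟩ := exists_map_eq_of_orthogonal_ker hBV hndV hTV' (y := ⟨y, hy⟩)
        fun k hk => hyk k k.2 (congrArg Subtype.val hk)
      exact ⟨x, x.2, congrArg Subtype.val hx⟩
    -- The kernel is totally isotropic because all its vectors are null.
    have hkβ₀ (k : X) (hk : k ∈ V) (hTk : T k = 0) : B k β₀ = 0 := by
      have h1 := hker _ (V.add_mem hk hβ₀) (by rw [map_add, hTk, hTβ₀, add_zero])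
      have h2 : B β₀ k = B k β₀ := hB.eq β₀ k
      simp only [map_add, LinearMap.add_apply, hker k hk hTk, hβ₀β₀, h2] at h1
      linarith
    obtain ⟨w₀, hw₀, hTw₀⟩ := hrange hβ₀ hkβ₀
    have hβ₀w₀ : B β₀ w₀ = 0 := hTw₀ ▸ form_self_map_eq_zero hB hT w₀
    have hdep {u : X} (hu : u ∈ V) (hβu : B β₀ u = 0) (huu : B u u = 0) : ∃ t : ℝ, u = t • β₀ := by
      obtain ⟨t, ht⟩ := (h.nonneg_of_null hB hβ₀ hβ₀β₀ (hex hβ₀ hβ₀0) hu hβu).2 huu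
      exact ⟨t, sub_eq_zero.mp (hnd _ (V.sub_mem hu (V.smul_mem t hβ₀)) ht)⟩
    have hw₀pos : 0 < B w₀ w₀ := by
      refine lt_of_le_of_ne
        (h.nonneg_of_null hB hβ₀ hβ₀β₀ (hex hβ₀ hβ₀0) hw₀ hβ₀w₀).1 fun h0 => ?_
      obtain ⟨t, ht⟩ := hdep hw₀ hβ₀w₀ h0.symm
      rw [ht, map_smul, hTβ₀, smul_zero] at hTw₀
      exact hβ₀0 hTw₀.symm
    obtain ⟨a, ha⟩ : ∃ a : ℝ, a * (a * B w₀ w₀) = 1 :=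
      ⟨(Real.sqrt (B w₀ w₀))⁻¹, by
        nth_rewrite 3 [← Real.mul_self_sqrt hw₀pos.le]
        have := (Real.sqrt_pos.mpr hw₀pos).ne'
        field_simp⟩
    set w := a • w₀ with hw
    have hwV : w ∈ V := V.smul_mem _ hw₀
    have hww : B w w = 1 := by simpa [hw] using ha
    set β := T w with hβ
    have hβV : β ∈ V := hTV w hwV
    have hββ₀ : β = a • β₀ := by rw [hβ, hw, map_smul, hTw₀]
    have hTβ : T β = 0 := by rw [hββ₀, map_smul, hTβ₀, smul_zero]
    have hββ := hker β hβV hTβ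
    have hβw : B β w = 0 := form_self_map_eq_zero hB hT w
    obtain ⟨η₀, hη₀, hTη₀⟩ := hrange hwV fun k hk hTk => by
      obtain ⟨t, rfl⟩ := hdep hk ((hB.eq _ _).symm.trans (hkβ₀ k hk hTk)) (hker k hk hTk)
      simp [hw, hβ₀w₀]
    have hη₀β : B η₀ β = -1 := by
      have := hT η₀ w
      rw [hTη₀, hww] at this
      linarith
    -- Adding a multiple of `β` to `η₀` normalizes the length to `-1`.
    set η := η₀ + ((B η₀ η₀ + 1) / 2) • β with hη
    have hηV : η ∈ V := V.add_mem hη₀ (V.smul_mem _ hβV)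
    have hTη : T η = w := by rw [hη, map_add, map_smul, hTβ, smul_zero, add_zero, hTη₀]
    have hβη₀ : B β η₀ = -1 := (hB.eq _ _).trans hη₀β
    have hηβ : B η β = -1 := by simp [hη, hη₀β, hββ]
    have hβη : B β η = -1 := (hB.eq _ _).trans hηβ
    have hηη : B η η = -1 := by
      simp only [hη, map_add, map_smul, LinearMap.add_apply, LinearMap.smul_apply, hη₀β, hββ, hβη₀,
        smul_eq_mul]
      ring
    have hwη : B w η = 0 := by
      have := form_self_map_eq_zero hB hT η
      rwa [hTη] at this
    have hηw : B η w = 0 := (hB.eq _ _).symm.trans hwη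
    have hwβ : B w β = 0 := (hB.eq _ _).symm.trans hβw
    have hoT : (1 : ℝ) • T = T := one_smul _ _
    obtain ⟨l, lam, b, h1, h2, h3⟩ := exists_isFrame_extend hB hT hTV h hnd hker
      (ε := eps3) (M := matL3) (b := ![η, w, η - β])
      (by
        intro i
        fin_cases i
        · exact hηV
        · exact hwV
        · exact V.sub_mem hηV hβV)
      (by
        intro i j
        fin_cases i <;> fin_cases j <;>
          simp [eps3, hηη, hww, hββ, hηβ, hβη, hηw, hwη, hβw, hwβ])
      (by
        intro j
        fin_cases j <;> simp [matL3, Fin.sum_univ_three, hTη, hTβ, ← hβ])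
      ⟨0, rfl⟩
    exact ⟨1, one_ne_zero, l, lam, h1, h2, Or.inr ⟨b, hoT.symm ▸ h3⟩⟩

end Forms

/-! ### Signature -/

section Signature

variable {X : Type*} [AddCommGroup X] [Module ℝ X] [FiniteDimensional ℝ X] {B : BilinForm ℝ X}

theorem card_le_sigNeg_of_orthogonal {k : ℕ} (f : Fin k → X)
    (hf : ∀ i j, i ≠ j → B (f i) (f j) = 0) (hneg : ∀ i, B (f i) (f i) < 0) :
    k ≤ sigNeg (LinearMap.BilinMap.toQuadraticMap B) := by
  have key (c : Fin k → ℝ) (i : Fin k) : B (∑ j, c j • f j) (f i) = c i * B (f i) (f i) := by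
    rw [map_sum, LinearMap.sum_apply, Finset.sum_eq_single i]
    · rw [LinearMap.map_smul₂, smul_eq_mul]
    · intro j _ hj
      rw [LinearMap.map_smul₂, hf j i hj, smul_zero]
    · simp
  have hli : LinearIndependent ℝ f := by
    rw [Fintype.linearIndependent_iff]
    intro c hc i
    have := key c i
    rw [hc, map_zero, LinearMap.zero_apply] at this
    exact (mul_eq_zero.mp this.symm).resolve_right (hneg i).ne
  have hpd : ((-(LinearMap.BilinMap.toQuadraticMap B)).restrict
      (Submodule.span ℝ (Set.range f))).PosDef := by
    rintro ⟨x, hx⟩ hx0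
    obtain ⟨c, rfl⟩ := (Submodule.mem_span_range_iff_exists_fun ℝ).mp hx
    obtain ⟨i, hi⟩ : ∃ i, c i ≠ 0 := by
      by_contra! hcon
      exact hx0 (Subtype.ext (by simp [hcon]))
    change 0 < -B (∑ j, c j • f j) (∑ j, c j • f j)
    rw [neg_pos, map_sum]
    have hterm (j : Fin k) : B (∑ j, c j • f j) (c j • f j) = c j * c j * B (f j) (f j) := by
      rw [map_smul, key, smul_eq_mul, mul_assoc]
    refine Finset.sum_neg' (fun j _ => ?_) ⟨i, Finset.mem_univ i, ?_⟩
    · rw [hterm]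
      exact mul_nonpos_of_nonneg_of_nonpos (mul_self_nonneg _) (hneg j).le
    · rw [hterm]
      exact mul_neg_of_pos_of_neg (mul_self_pos.mpr hi) (hneg i)
  have := le_sigNeg_of_negDef _ hpd
  rwa [finrank_span_eq_card hli, Fintype.card_fin] at this

/-- If `B` has index two, then the orthogonal complement of a non-zero null vector `α` has index one
modulo its radical. Two orthogonal negative vectors of `α^⊥`, together with a negative vector of the
form `h₀ + tα`, would give index three. -/
theorem isSemiLorentzian_orthogonal (hB : B.IsSymm) (hnd : B.Nondegenerate)
    (hsig : sigNeg (LinearMap.BilinMap.toQuadraticMap B) = 2) {α : X} (hα : α ≠ 0)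
    (hαα : B α α = 0) : IsSemiLorentzian B (LinearMap.ker (B α)) := by
  have hno (e y : X) (he : B α e = 0) (hee : B e e < 0) (hy : B α y = 0) (hey : B e y = 0) :
      0 ≤ B y y := by
    by_contra! hyy
    have hye : B y e = 0 := (hB.eq y e).trans hey
    have heα : B e α = 0 := (hB.eq e α).trans he
    have hyα : B y α = 0 := (hB.eq y α).trans hy
    obtain ⟨z, hz⟩ : ∃ z, B α z ≠ 0 := by
      by_contra! hcon
      exact hα (hnd.1 α hcon)
    -- Some `h` orthogonal to `e` and `y` but not to `α` is negative, which gives index three.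
    set h₀ := z - (B e z / B e e) • e - (B y z / B y y) • y with hh₀
    have hαh₀ : B α h₀ ≠ 0 := by simpa [hh₀, he, hy] using hz
    have heh₀ : B e h₀ = 0 := by
      simp [hh₀, hey, div_mul_cancel₀ _ hee.ne]
    have hyh₀ : B y h₀ = 0 := by
      simp [hh₀, hye, div_mul_cancel₀ _ hyy.ne]
    have hh₀α : B h₀ α = B α h₀ := hB.eq h₀ α
    set h := h₀ + (-(B h₀ h₀ + 1) / (2 * B α h₀)) • α with hh
    have hhh : B h h = -1 := by
      simp only [hh, map_add, map_smul, LinearMap.add_apply, LinearMap.smul_apply, hh₀α, hαα,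
        smul_eq_mul]
      field_simp
      ring
    have heh : B e h = 0 := by simp [hh, heh₀, heα]
    have hyh : B y h = 0 := by simp [hh, hyh₀, hyα]
    have hhe : B h e = 0 := (hB.eq h e).trans heh
    have hhy : B h y = 0 := (hB.eq h y).trans hyh
    have := card_le_sigNeg_of_orthogonal (B := B) ![e, y, h]
      (by
        intro i j hij
        fin_cases i <;> fin_cases j <;> simp_all)
      (by
        intro i
        fin_cases i
        · exact hee
        · exact hyy
        · change B h h < 0
          rw [hhh]
          norm_num)
    omega
  refine ⟨?_, fun e he hee y hy hey => hno e y he hee hy hey, fun e he hee y hy hey hyy z hz => ?_⟩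
  · obtain ⟨V, hV, hneg⟩ := exists_finrank_eq_sigNeg_and_negDef
      (LinearMap.BilinMap.toQuadraticMap B)
    have hker : LinearMap.ker ((B α).domRestrict V) ≠ ⊥ :=
      LinearMap.ker_ne_bot_of_finrank_lt (by rw [Module.finrank_self, hV, hsig]; norm_num)
    obtain ⟨⟨e, heV⟩, he, he0⟩ := Submodule.exists_mem_ne_zero_of_ne_bot hker
    have h1 : 0 < -B e e := hneg ⟨e, heV⟩ he0
    exact ⟨e, he, by linarith⟩
  · by_contra hyz
    rw [LinearMap.mem_ker] at he hy hz
    have hye : B y e = 0 := (hB.eq y e).trans hey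
    set z' := z - (B e z / B e e) • e with hz'
    have hαz' : B α z' = 0 := by simp [hz', he, hz]
    have hez' : B e z' = 0 := by simp [hz', div_mul_cancel₀ _ hee.ne]
    have hyz' : B y z' = B y z := by simp [hz', hye]
    have hz'y : B z' y = B y z := (hB.eq z' y).trans hyz'
    have h1 := hno e (z' + (-(B z' z' + 1) / (2 * B y z)) • y) he hee
      (by simp [hαz', hy]) (by simp [hez', hey])
    have h2 : B (z' + (-(B z' z' + 1) / (2 * B y z)) • y)
        (z' + (-(B z' z' + 1) / (2 * B y z)) • y) = -1 := by
      simp only [map_add, map_smul, LinearMap.add_apply, LinearMap.smul_apply, hz'y, hyz', hyy,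
        smul_eq_mul]
      field_simp
      ring
    linarith

end Signature

/-! ### Double extensions of abelian Lorentzian algebras -/

section Extension

variable {L : Type*} [LieRing L] [LieAlgebra ℝ L] {Φ : ScalarProduct L}

theorem HasSignature.finrank_eq [FiniteDimensional ℝ L] {p q : ℕ} (h : HasSignature Φ p q) :
    Module.finrank ℝ L = p + q := by
  have hrad : (LinearMap.BilinMap.toQuadraticMap Φ.form).radical = ⊥ := by
    rw [QuadraticMap.radical_eq_ker_polarBilin, LinearMap.ker_eq_bot']
    intro x hx
    refine Φ.nondegenerate.1 x fun y => ?_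
    have h1 := LinearMap.congr_fun hx y
    simp only [QuadraticMap.polarBilin_apply_apply, LinearMap.BilinMap.polar_toQuadraticMap,
      LinearMap.zero_apply, Φ.symm.eq y x] at h1
    linarith
  have := QuadraticForm.sigPos_add_sigNeg_add_radical
    (Q := LinearMap.BilinMap.toQuadraticMap Φ.form)
  rw [hrad, finrank_bot, h.1, h.2] at this
  omega

/-- An ideal of an indecomposable metric Lie algebra on which the scalar product is non-degenerate
vanishes, unless it is the whole algebra. -/
theorem IsIndecomposable.eq_bot [FiniteDimensional ℝ L] (hind : IsIndecomposable Φ)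
    (W : Submodule ℝ L) (hW : ∀ x : L, ∀ y ∈ W, ⁅x, y⁆ ∈ W)
    (hnd : ∀ y ∈ W, (∀ z ∈ W, Φ.form y z = 0) → y = 0) {v : L} (hv : v ≠ 0)
    (hvW : ∀ w ∈ W, Φ.form w v = 0) : W = ⊥ := by
  by_contra hne
  let I : LieIdeal ℝ L := { W with lie_mem := fun {x m} hm => hW x m hm }
  refine hind ⟨I, LieAlgebra.InvariantForm.orthogonal Φ.form Φ.invariant I, ?_, ?_, ?_, ?_⟩
  · intro h
    exact hne (congrArg LieSubmodule.toSubmodule h)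
  · intro h
    refine hv ((LieSubmodule.mem_bot (R := ℝ) (L := L) v).mp (h ▸ ?_))
    exact (LieAlgebra.InvariantForm.mem_orthogonal _ _ _ _).mpr hvW
  · rw [← LieSubmodule.isCompl_toSubmodule, LieAlgebra.InvariantForm.orthogonal_toSubmodule,
      LinearMap.BilinForm.isCompl_orthogonal_iff_disjoint Φ.symm.isRefl, Submodule.disjoint_def]
    intro y hy hy'
    refine hnd y hy fun z hz => ?_
    rw [Φ.symm.eq]
    exact LinearMap.BilinForm.mem_orthogonal_iff.mp hy' z hz
  · intro x hx y hy
    exact (LieAlgebra.InvariantForm.mem_orthogonal _ _ _ _).mp hy x hx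

/-- A central vector that is not null would span a direct summand. -/
theorem IsIndecomposable.null_of_central [FiniteDimensional ℝ L] (hind : IsIndecomposable Φ)
    (hdim : 2 ≤ Module.finrank ℝ L) {z : L} (hz : ∀ x : L, ⁅x, z⁆ = 0) : Φ.form z z = 0 := by
  by_contra hzz
  have hker : LinearMap.ker (Φ.form z) ≠ ⊥ :=
    LinearMap.ker_ne_bot_of_finrank_lt (by rw [Module.finrank_self]; omega)
  obtain ⟨v, hv, hv0⟩ := Submodule.exists_mem_ne_zero_of_ne_bot hker
  have hbot := hind.eq_bot (ℝ ∙ z)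
    (by
      intro x y hy
      obtain ⟨c, rfl⟩ := Submodule.mem_span_singleton.mp hy
      rw [lie_smul, hz, smul_zero]
      exact Submodule.zero_mem _)
    (by
      intro y hy h
      obtain ⟨c, rfl⟩ := Submodule.mem_span_singleton.mp hy
      have := h z (Submodule.mem_span_singleton_self z)
      rw [LinearMap.map_smul₂, smul_eq_mul] at this
      rw [(mul_eq_zero.mp this).resolve_right hzz, zero_smul])
    hv0
    (by
      intro w hw
      obtain ⟨c, rfl⟩ := Submodule.mem_span_singleton.mp hw
      rw [LinearMap.map_smul₂, LinearMap.mem_ker.mp hv, smul_zero])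
  rw [Submodule.span_singleton_eq_bot] at hbot
  exact hzz (by rw [hbot, map_zero])

/-- A metric Lie algebra with a central null vector `α` such that `α^⊥` is abelian modulo `α` is
the double extension given by the matrix of `ad H` in a frame of `{α, H}^⊥`. -/
theorem isIsomorphic_abelianExtension {α H : L} (hα : ∀ x : L, ⁅x, α⁆ = 0)
    (hαα : Φ.form α α = 0) (hαH : Φ.form α H = 1) (hHH : Φ.form H H = 0)
    (hab : ∀ x y, Φ.form α x = 0 → Φ.form α y = 0 → ∃ t : ℝ, ⁅x, y⁆ = t • α)
    {V : Submodule ℝ L} (hV : ∀ x, x ∈ V ↔ Φ.form α x = 0 ∧ Φ.form H x = 0)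
    {ι : Type*} [Fintype ι] [DecidableEq ι] {ε : ι → ℤˣ} {M : Matrix ι ι ℝ} {b : ι → L}
    (hM : ∀ i j, ((ε i : ℤ) : ℝ) * M i j = -(((ε j : ℤ) : ℝ) * M j i))
    (hb : IsFrame Φ.form (LieAlgebra.ad ℝ L H) V ε M b) :
    IsIsomorphic Φ (abelianExtension ε M hM) ∧ Module.finrank ℝ L = 2 + Fintype.card ι := by
  let A := PseudoEuclidean.antisymmDerivation M hM
  let g : PseudoEuclidean ε →ₗ[ℝ] L := (Fintype.linearCombination ℝ b : (ι → ℝ) →ₗ[ℝ] L)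
  have hg (x : PseudoEuclidean ε) : g x = ∑ i, x i • b i := rfl
  have hgV (x) : g x ∈ V := V.sum_mem fun i _ => V.smul_mem _ (hb.mem i)
  have hgb (x : PseudoEuclidean ε) (i) : Φ.form (g x) (b i) = ((ε i : ℤ) : ℝ) * x i := by
    rw [hg, map_sum, LinearMap.sum_apply, Finset.sum_eq_single i]
    · rw [LinearMap.map_smul₂, hb.orthonormal, if_pos rfl, smul_eq_mul, mul_comm]
    · intro j _ hj
      rw [LinearMap.map_smul₂, hb.orthonormal, if_neg hj, smul_zero]
    · simp
  have hgg (x y : PseudoEuclidean ε) :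
      Φ.form (g x) (g y) = (PseudoEuclidean.scalarProduct ε).form x y := by
    change _ = ∑ i, ((ε i : ℤ) : ℝ) * x i * y i
    rw [hg y, map_sum]
    refine Finset.sum_congr rfl fun i _ => ?_
    rw [map_smul, hgb, smul_eq_mul, mul_comm]
  have hHg (x : PseudoEuclidean ε) : ⁅H, g x⁆ = g (A.der x) := by
    have h1 : ⁅H, g x⁆ = ∑ j, x j • ∑ i, M i j • b i := by
      rw [hg, lie_sum]
      exact Finset.sum_congr rfl fun j _ => by rw [lie_smul, ← hb.map j, LieAlgebra.ad_apply]
    have h2 : g (A.der x) = ∑ i, (∑ j, M i j * x j) • b i := rfl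
    rw [h1, h2]
    simp only [Finset.smul_sum, Finset.sum_smul, smul_smul]
    rw [Finset.sum_comm]
    exact Finset.sum_congr rfl fun i _ => Finset.sum_congr rfl fun j _ => by rw [mul_comm]
  have hHα : Φ.form H α = 1 := (Φ.symm.eq H α).trans hαH
  have hVα (x) (hx : x ∈ V) : Φ.form x α = 0 := (Φ.symm.eq x α).trans ((hV x).mp hx).1
  have hVH (x) (hx : x ∈ V) : Φ.form x H = 0 := (Φ.symm.eq x H).trans ((hV x).mp hx).2
  have hgl (x y : PseudoEuclidean ε) :
      ⁅g x, g y⁆ = (PseudoEuclidean.scalarProduct ε).form (A.der x) y • α := by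
    obtain ⟨t, ht⟩ := hab (g x) (g y) ((hV _).mp (hgV x)).1 ((hV _).mp (hgV y)).1
    have h1 : Φ.form ⁅g x, g y⁆ H = t := by rw [ht, LinearMap.map_smul₂, hαH, smul_eq_mul, mul_one]
    have h2 : Φ.form ⁅g x, g y⁆ H = Φ.form ⁅H, g x⁆ (g y) := by
      rw [Φ.invariant, ← lie_skew H (g x), map_neg, LinearMap.neg_apply, Φ.symm.eq]
    rw [ht, ← h1, h2, hHg, hgg]
  have hαl (x : L) : ⁅α, x⁆ = 0 := by rw [← lie_skew, hα, neg_zero]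
  let f : DoubleExtension A →ₗ[ℝ] L :=
    { toFun := fun u => u.1 • α + g u.2.1 + u.2.2 • H
      map_add' := fun u v => by
        simp only [DoubleExtension.add_fst, DoubleExtension.add_snd_fst,
          DoubleExtension.add_snd_snd, map_add]
        module
      map_smul' := fun c u => by
        simp only [DoubleExtension.smul_fst, DoubleExtension.smul_snd_fst,
          DoubleExtension.smul_snd_snd, map_smul, RingHom.id_apply]
        module }
  have hf (u) : f u = u.1 • α + g u.2.1 + u.2.2 • H := rfl
  have hform (u v) : Φ.form (f u) (f v) = DoubleExtension.form A u v := by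
    have h1 := hVα _ (hgV u.2.1)
    have h2 := hVH _ (hgV u.2.1)
    have h3 := ((hV _).mp (hgV v.2.1)).1
    have h4 := ((hV _).mp (hgV v.2.1)).2
    simp only [hf, DoubleExtension.form_apply, map_add, map_smul, LinearMap.add_apply,
      LinearMap.smul_apply, hαα, hαH, hHα, hHH, h1, h2, h3, h4, hgg, smul_eq_mul]
    ring
  have hlie (u v) : f ⁅u, v⁆ = ⁅f u, f v⁆ := by
    have h1 : ⁅g u.2.1, H⁆ = -g (A.der u.2.1) := by rw [← lie_skew, hHg]
    simp only [hf, DoubleExtension.bracket_fst, DoubleExtension.bracket_snd_fst,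
      DoubleExtension.bracket_snd_snd, PseudoEuclidean.lie_eq_zero, add_lie, lie_add, smul_lie,
      lie_smul, hα, hαl, hgl, hHg, h1, lie_self, map_add, map_sub, map_smul, map_zero]
    module
  have hbij : Function.Bijective f := by
    constructor
    · rw [← LinearMap.ker_eq_bot, LinearMap.ker_eq_bot']
      intro u hu
      refine DoubleExtension.form_separating A u fun v => ?_
      rw [← hform, hu, map_zero, LinearMap.zero_apply]
    · intro x
      let c : PseudoEuclidean ε := fun i => ((ε i : ℤ) : ℝ) * Φ.form x (b i)
      let u : DoubleExtension A :=
        ((Φ.form x H, c, Φ.form x α) : ℝ × PseudoEuclidean ε × ℝ)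
      have hu : f u = Φ.form x H • α + g c + Φ.form x α • H := rfl
      have hc (i) : c i = ((ε i : ℤ) : ℝ) * Φ.form x (b i) := rfl
      refine ⟨u, (sub_eq_zero.mp (hb.complete (x - f u) ((hV _).mpr ⟨?_, ?_⟩) fun i => ?_)).symm⟩
      · have h1 := ((hV _).mp (hgV c)).1
        simp [hu, hαα, hαH, h1, Φ.symm.eq α x]
      · have h1 := ((hV _).mp (hgV c)).2
        simp [hu, hHH, hHα, h1, Φ.symm.eq H x]
      · have h1 := ((hV _).mp (hb.mem i)).1
        have h2 := ((hV _).mp (hb.mem i)).2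
        have h3 : ((ε i : ℤ) : ℝ) * ((ε i : ℤ) : ℝ) = 1 := by
          rcases Int.units_eq_one_or (ε i) with h | h <;> simp [h]
        rw [map_sub, LinearMap.sub_apply, hu]
        simp only [map_add, LinearMap.add_apply, LinearMap.map_smul₂, h1, h2, hgb, hc,
          smul_zero, zero_add, add_zero]
        rw [← mul_assoc, h3, one_mul, sub_self]
  let F : DoubleExtension A ≃ₗ⁅ℝ⁆ L :=
    LieEquiv.ofBijective { f with map_lie' := fun {u v} => hlie u v } hbij
  have hF (u) : F u = f u := rfl
  refine ⟨⟨F.symm, fun x y => ?_⟩, ?_⟩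
  · obtain ⟨u, rfl⟩ : ∃ u, F u = x := ⟨F.symm x, F.apply_symm_apply x⟩
    obtain ⟨v, rfl⟩ : ∃ v, F v = y := ⟨F.symm y, F.apply_symm_apply y⟩
    rw [LieEquiv.symm_apply_apply, LieEquiv.symm_apply_apply, hF, hF, hform]
    rfl
  · rw [← F.toLinearEquiv.finrank_eq]
    change Module.finrank ℝ (ℝ × (ι → ℝ) × ℝ) = _
    simp only [Module.finrank_prod, Module.finrank_self, Module.finrank_fintype_fun_eq_card]
    omega

/-- The classification under the condition to which both hypotheses of the proposition reduce: there
is a central vector `α` for which `α^⊥` is abelian modulo `α`. -/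
theorem isListed_of_central [FiniteDimensional ℝ L] {n : ℕ} (hn : 2 ≤ n)
    (hsig : HasSignature Φ 2 (n - 2)) (hind : IsIndecomposable Φ) {α : L} (hα0 : α ≠ 0)
    (hα : ∀ x : L, ⁅x, α⁆ = 0)
    (hab : ∀ x y, Φ.form α x = 0 → Φ.form α y = 0 → ∃ t : ℝ, ⁅x, y⁆ = t • α) :
    IsListed Φ n := by
  have hdim : Module.finrank ℝ L = n := by rw [hsig.finrank_eq]; omega
  have hαα := hind.null_of_central (hdim ▸ hn) hα
  obtain ⟨z, hz⟩ : ∃ z, Φ.form α z ≠ 0 := by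
    by_contra! hcon
    exact hα0 (Φ.nondegenerate.1 α hcon)
  set z₁ := (Φ.form α z)⁻¹ • z with hz₁
  have hαz₁ : Φ.form α z₁ = 1 := by simp [hz₁, hz]
  have hz₁α : Φ.form z₁ α = 1 := (Φ.symm.eq _ _).trans hαz₁
  -- The multiple of `α` makes `H` a null vector.
  set H := z₁ - (Φ.form z₁ z₁ / 2) • α with hH
  have hαH : Φ.form α H = 1 := by simp [hH, hαα, hαz₁]
  have hHα : Φ.form H α = 1 := (Φ.symm.eq _ _).trans hαH
  have hHH : Φ.form H H = 0 := by
    simp only [hH, map_sub, map_smul, LinearMap.sub_apply, LinearMap.smul_apply, hαα, hαz₁, hz₁α,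
      smul_eq_mul]
    ring
  let V : Submodule ℝ L := LinearMap.ker (Φ.form α) ⊓ LinearMap.ker (Φ.form H)
  have hV (x) : x ∈ V ↔ Φ.form α x = 0 ∧ Φ.form H x = 0 := by simp [V]
  have hE := isSemiLorentzian_orthogonal Φ.symm Φ.nondegenerate hsig.1 hα0 hαα
  have hnd (y) (hy : y ∈ V) (h : ∀ z ∈ V, Φ.form y z = 0) : y = 0 := by
    refine Φ.nondegenerate.1 y fun z => ?_
    have h1 := h (z - Φ.form α z • H - Φ.form H z • α) ((hV _).mpr (by
      simp [hαα, hαH, hHH, hHα]))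
    have h2 : Φ.form y α = 0 := (Φ.symm.eq _ _).trans ((hV y).mp hy).1
    have h3 : Φ.form y H = 0 := (Φ.symm.eq _ _).trans ((hV y).mp hy).2
    simpa [h2, h3] using h1
  have hVL : IsSemiLorentzian Φ.form V := by
    refine ⟨?_, fun e he hee y hy => hE.nonneg e ((hV e).mp he).1 hee y ((hV y).mp hy).1,
      fun e he hee y hy hey hyy z hz =>
        hE.radical e ((hV e).mp he).1 hee y ((hV y).mp hy).1 hey hyy z ((hV z).mp hz).1⟩
    obtain ⟨e, he, hee⟩ := hE.exists_neg
    rw [LinearMap.mem_ker] at he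
    have heα : Φ.form e α = 0 := (Φ.symm.eq _ _).trans he
    refine ⟨e - Φ.form H e • α, (hV _).mpr ?_, ?_⟩
    · simp [he, hαα, hHα]
    · simpa [he, heα, hαα] using hee
  have hker (x) (hx : x ∈ V) (hHx : LieAlgebra.ad ℝ L H x = 0) : Φ.form x x = 0 := by
    rw [LieAlgebra.ad_apply] at hHx
    refine hind.null_of_central (hdim ▸ hn) fun y => ?_
    have h1 (y) (hy : Φ.form α y = 0) : ⁅y, x⁆ = 0 := by
      obtain ⟨t, ht⟩ := hab y x hy ((hV x).mp hx).1
      have h2 : Φ.form ⁅y, x⁆ H = 0 := by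
        rw [Φ.invariant, ← lie_skew, map_neg, neg_neg, Φ.symm.eq, Φ.invariant, hHx, map_zero,
          neg_zero]
      rw [ht, LinearMap.map_smul₂, hαH, smul_eq_mul, mul_one] at h2
      rw [ht, h2, zero_smul]
    have h3 := h1 (y - Φ.form α y • H) (by simp [hαH])
    rwa [sub_lie, smul_lie, hHx, smul_zero, sub_zero] at h3
  obtain ⟨c, hc, l, lam, hpos, hmono, hb⟩ := exists_isFrame_of_semiLorentzian Φ.symm
    (T := LieAlgebra.ad ℝ L H) (V := V) (fun x y => Φ.invariant H x y)
    (fun x _ => by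
      refine (hV _).mpr ⟨?_, ?_⟩
      · rw [LieAlgebra.ad_apply, Φ.symm.eq, Φ.invariant, hα, map_zero, neg_zero]
      · rw [LieAlgebra.ad_apply, Φ.symm.eq, Φ.invariant, lie_self, map_zero, neg_zero])
    hVL hnd hker
  rw [show c • LieAlgebra.ad ℝ L H = LieAlgebra.ad ℝ L (c • H) from (map_smul _ c H).symm] at hb
  -- Replacing `H` by `c • H` and `α` by `c⁻¹ • α` rescales the operator by `c`.
  have key {ι : Type} [Fintype ι] [DecidableEq ι] {ε : ι → ℤˣ} {M : Matrix ι ι ℝ} {b : ι → L}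
      (hM : ∀ i j, ((ε i : ℤ) : ℝ) * M i j = -(((ε j : ℤ) : ℝ) * M j i))
      (hb : IsFrame Φ.form (LieAlgebra.ad ℝ L (c • H)) V ε M b) :
      IsIsomorphic Φ (abelianExtension ε M hM) ∧ Module.finrank ℝ L = 2 + Fintype.card ι :=
    isIsomorphic_abelianExtension (α := c⁻¹ • α) (H := c • H)
      (fun x => by rw [lie_smul, hα, smul_zero]) (by simp [hαα]) (by simp [hαH, hc])
      (by simp [hHH])
      (fun x y hx hy => by
        obtain ⟨t, ht⟩ := hab x y (by simpa [hc] using hx) (by simpa [hc] using hy)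
        exact ⟨t * c, by rw [ht, smul_smul, mul_assoc, mul_inv_cancel₀ hc, mul_one]⟩)
      (fun x => by simp [hV, hc]) hM hb
  rcases hb with ⟨b, hb⟩ | ⟨b, hb⟩
  · obtain ⟨hiso, hcard⟩ := key (fromBlocks_antisymm matL2_antisymm lam) hb
    have hnl : n = 4 + 2 * l := by
      rw [hdim] at hcard
      simp at hcard
      omega
    rcases Nat.eq_zero_or_pos l with rfl | hl
    · exact Or.inl ⟨hnl, (key matL2_antisymm hb.comp_inl).1⟩
    · exact Or.inr (Or.inr (Or.inl ⟨by omega, ⟨2 + l, by omega⟩, l, lam, by omega, hpos, hmono,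
        hiso⟩))
  · obtain ⟨hiso, hcard⟩ := key (fromBlocks_antisymm matL3_antisymm lam) hb
    have hnl : n = 5 + 2 * l := by
      rw [hdim] at hcard
      simp at hcard
      omega
    rcases Nat.eq_zero_or_pos l with rfl | hl
    · exact Or.inr (Or.inl ⟨hnl, (key matL3_antisymm hb.comp_inl).1⟩)
    · exact Or.inr (Or.inr (Or.inr ⟨by omega, ⟨2 + l, by omega⟩, l, lam, by omega, hpos, hmono,
        hiso⟩))

end Extension

/-! ### The Killing form and one-dimensional centres -/

section Trace

variable {X : Type*} [AddCommGroup X] [Module ℝ X] [FiniteDimensional ℝ X]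

/-- In an orthogonal basis the trace of `S²` is a sum of terms `-⟨S v, S v⟩ / ⟨v, v⟩`, one for each
basis vector `v` that is not null. -/
theorem form_map_map_eq_zero_of_trace_sq (B : BilinForm ℝ X) (hB : B.IsSymm)
    (hpsd : ∀ x, 0 ≤ B x x) (S : X →ₗ[ℝ] X) (hS : ∀ x y, B (S x) y = -B x (S y))
    (hnull : ∀ x, B x x = 0 → S x = 0) (htr : LinearMap.trace ℝ X (S ∘ₗ S) = 0) (x : X) :
    B (S x) (S x) = 0 := by
  obtain ⟨v, hv⟩ := LinearMap.BilinForm.exists_orthogonal_basis (B := B) ⟨hB.eq⟩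
  have hvx (y : X) (i) : B y (v i) = v.repr y i * B (v i) (v i) := by
    conv_lhs => rw [← v.sum_repr y]
    rw [map_sum, LinearMap.sum_apply, Finset.sum_eq_single i]
    · rw [LinearMap.map_smul₂, smul_eq_mul]
    · intro j _ hj
      rw [LinearMap.map_smul₂, hv hj, smul_zero]
    · simp
  have hdiag (i) : v.repr (S (S (v i))) i ≤ 0 ∧
      (v.repr (S (S (v i))) i = 0 → B (S (v i)) (S (v i)) = 0) := by
    rcases (hpsd (v i)).eq_or_lt with h0 | hpos
    · simp [hnull _ h0.symm]
    · have h1 := hvx (S (S (v i))) i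
      rw [hS] at h1
      refine ⟨?_, fun h0 => ?_⟩
      · by_contra! hcon
        nlinarith [hpsd (S (v i)), mul_pos hcon hpos]
      · rw [h0, zero_mul] at h1
        exact neg_eq_zero.mp h1
  have htr' : ∑ i, v.repr (S (S (v i))) i = 0 := by
    rw [← htr, LinearMap.trace_eq_matrix_trace ℝ v, Matrix.trace]
    exact Finset.sum_congr rfl fun i _ => by
      rw [Matrix.diag_apply, LinearMap.toMatrix_apply, LinearMap.comp_apply]
  have h0 (i) : S (S (v i)) = 0 :=
    hnull _ ((hdiag i).2
      ((Finset.sum_eq_zero_iff_of_nonpos fun i _ => (hdiag i).1).mp htr' i (Finset.mem_univ i)))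
  have hSS : S ∘ₗ S = 0 := v.ext fun i => by simpa using h0 i
  have := LinearMap.congr_fun hSS x
  rw [hS, show S (S x) = 0 from this, map_zero, neg_zero]

end Trace

variable {L : Type*} [LieRing L] [LieAlgebra ℝ L] [FiniteDimensional ℝ L] {Φ : ScalarProduct L}
  {α : L}

omit [FiniteDimensional ℝ L] in
theorem form_lie_eq_zero_of_central (hα : ∀ x : L, ⁅x, α⁆ = 0) (x y : L) :
    Φ.form α ⁅x, y⁆ = 0 := by
  have h := Φ.invariant x α y
  rw [hα, map_zero, LinearMap.zero_apply] at h
  exact neg_eq_zero.mp h.symm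

omit [FiniteDimensional ℝ L] in
theorem form_lie_self_eq_zero (x y : L) : Φ.form ⁅x, y⁆ x = 0 := by
  rw [Φ.invariant, lie_self, map_zero, neg_zero]

omit [FiniteDimensional ℝ L] in
theorem exists_eq_smul_of_orthogonal (hα0 : α ≠ 0) {y : L}
    (hy : ∀ z, Φ.form α z = 0 → Φ.form y z = 0) : ∃ t : ℝ, y = t • α := by
  obtain ⟨z₀, hz₀⟩ : ∃ z, Φ.form α z ≠ 0 := by
    by_contra! hcon
    exact hα0 (Φ.nondegenerate.1 α hcon)
  refine ⟨Φ.form y z₀ / Φ.form α z₀, sub_eq_zero.mp (Φ.nondegenerate.1 _ fun z => ?_)⟩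
  have h1 := hy (z - (Φ.form α z / Φ.form α z₀) • z₀) (by simp [hz₀])
  rw [map_sub, map_smul, sub_eq_zero] at h1
  rw [map_sub, LinearMap.sub_apply, LinearMap.map_smul₂, h1, smul_eq_mul, smul_eq_mul]
  ring

/-- Since `ad x` maps into the orthogonal complement of `x` in `α^⊥`, its square has the same trace
there. -/
theorem form_lie_lie_eq_zero_of_killingForm (hα : ∀ x : L, ⁅x, α⁆ = 0) {x : L}
    (hpsd : ∀ f, Φ.form α f = 0 → Φ.form x f = 0 → 0 ≤ Φ.form f f)
    (hnull : ∀ f, Φ.form α f = 0 → Φ.form x f = 0 → Φ.form f f = 0 → ⁅x, f⁆ = 0)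
    (hκ : killingForm ℝ L x x = 0) {f : L} (hαf : Φ.form α f = 0) (hxf : Φ.form x f = 0) :
    Φ.form ⁅x, f⁆ ⁅x, f⁆ = 0 := by
  let F : Submodule ℝ L := LinearMap.ker (Φ.form α) ⊓ LinearMap.ker (Φ.form x)
  have hF (y) : ⁅x, y⁆ ∈ F :=
    ⟨form_lie_eq_zero_of_central hα x y, (Φ.symm.eq _ _).trans (form_lie_self_eq_zero x y)⟩
  have hSF : ∀ y ∈ F, LieAlgebra.ad ℝ L x y ∈ F := fun y _ => hF y
  refine form_map_map_eq_zero_of_trace_sq (Φ.form.restrict F) (Φ.symm.restrict F)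
    (fun y => hpsd y y.2.1 y.2.2) ((LieAlgebra.ad ℝ L x).restrict hSF)
    (fun y z => Φ.invariant x y z) (fun y hy => Subtype.ext (hnull y y.2.1 y.2.2 hy)) ?_
    ⟨f, hαf, hxf⟩
  rw [killingForm_apply_apply] at hκ
  rw [← hκ, ← LinearMap.trace_restrict_eq_of_forall_mem F
    (LieAlgebra.ad ℝ L x ∘ₗ LieAlgebra.ad ℝ L x) (fun y => hF _)]
  rfl

/-- If the Killing form vanishes on `α^⊥`, then `α^⊥` is abelian modulo `α`. For a negative vector
`e` this follows from `κ(e, e) = 0`, and the negative vectors span `α^⊥`. -/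
theorem exists_lie_eq_smul_of_killingForm (hα0 : α ≠ 0) (hα : ∀ x : L, ⁅x, α⁆ = 0)
    (hE : IsSemiLorentzian Φ.form (LinearMap.ker (Φ.form α)))
    (hκ : ∀ x y, Φ.form α x = 0 → Φ.form α y = 0 → killingForm ℝ L x y = 0) {x y : L}
    (hx : Φ.form α x = 0) (hy : Φ.form α y = 0) : ∃ t : ℝ, ⁅x, y⁆ = t • α := by
  have key (e y : L) (he : Φ.form α e = 0) (hee : Φ.form e e < 0) (hy : Φ.form α y = 0) :
      ∃ t : ℝ, ⁅e, y⁆ = t • α := by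
    have hrad (f : L) (hf : Φ.form α f = 0) (hef : Φ.form e f = 0) (hff : Φ.form f f = 0) :
        ∃ t : ℝ, f = t • α :=
      exists_eq_smul_of_orthogonal hα0 fun z hz => hE.radical e he hee f hf hef hff z hz
    have hmain (f : L) (hf : Φ.form α f = 0) (hef : Φ.form e f = 0) : ∃ t : ℝ, ⁅e, f⁆ = t • α :=
      hrad _ (form_lie_eq_zero_of_central hα e f)
        ((Φ.symm.eq _ _).trans (form_lie_self_eq_zero e f))
        (form_lie_lie_eq_zero_of_killingForm hα
          (fun g hg heg => hE.nonneg e he hee g hg heg)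
          (fun g hg heg hgg => by
            obtain ⟨t, rfl⟩ := hrad g hg heg hgg
            rw [lie_smul, hα, smul_zero])
          (hκ e e he he) hf hef)
    obtain ⟨t, ht⟩ := hmain (y - (Φ.form e y / Φ.form e e) • e) (by simp [hy, he])
      (by simp [div_mul_cancel₀ _ hee.ne])
    exact ⟨t, by rw [← ht, lie_sub, lie_smul, lie_self, smul_zero, sub_zero]⟩
  obtain ⟨e, he, hee⟩ := hE.exists_neg
  rw [LinearMap.mem_ker] at he
  obtain ⟨s, hs0, hs⟩ : ∃ s : ℝ, s ≠ 0 ∧ Φ.form (e + s • x) (e + s • x) < 0 := by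
    have hcont : Continuous fun s : ℝ => Φ.form (e + s • x) (e + s • x) := by
      simp only [map_add, map_smul, LinearMap.add_apply, LinearMap.smul_apply, smul_eq_mul]
      fun_prop
    have hev := hcont.continuousAt.eventually_lt (continuousAt_const (y := (0 : ℝ))) (x₀ := 0)
      (by simpa using hee)
    obtain ⟨s, hs, hs0⟩ := ((hev.filter_mono nhdsWithin_le_nhds).and
      (self_mem_nhdsWithin (s := {(0 : ℝ)}ᶜ))).exists
    exact ⟨s, hs0, hs⟩
  obtain ⟨t₁, ht₁⟩ := key e y he hee hy
  obtain ⟨t₂, ht₂⟩ := key (e + s • x) y (by simp [he, hx]) hs hy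
  rw [add_lie, smul_lie, ht₁, ← eq_sub_iff_add_eq', ← sub_smul] at ht₂
  exact ⟨s⁻¹ * (t₂ - t₁), by rw [mul_smul, ← ht₂, inv_smul_smul₀ hs0]⟩

variable (Φ α) in
/-- The radical of the restriction of the Killing form to `α^⊥`. -/
noncomputable def killingRadical : Submodule ℝ L :=
  LinearMap.ker (Φ.form α) ⊓
    LinearMap.BilinForm.orthogonal (killingForm ℝ L) (LinearMap.ker (Φ.form α))

omit [FiniteDimensional ℝ L] in
theorem mem_killingRadical {x : L} : x ∈ killingRadical Φ α ↔
    Φ.form α x = 0 ∧ ∀ y, Φ.form α y = 0 → killingForm ℝ L y x = 0 := by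
  rw [killingRadical, Submodule.mem_inf, LinearMap.mem_ker, LinearMap.BilinForm.mem_orthogonal_iff]
  rfl

omit [FiniteDimensional ℝ L] in
theorem lie_mem_killingRadical (hα : ∀ x : L, ⁅x, α⁆ = 0) (x : L) {y : L}
    (hy : y ∈ killingRadical Φ α) : ⁅x, y⁆ ∈ killingRadical Φ α := by
  refine mem_killingRadical.mpr ⟨form_lie_eq_zero_of_central hα x y, fun z _ => ?_⟩
  rw [← neg_eq_zero, ← LieModule.traceForm_lieInvariant ℝ L L x z y]
  exact (mem_killingRadical.mp hy).2 _ (form_lie_eq_zero_of_central hα x z)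

omit [FiniteDimensional ℝ L] in
theorem killingForm_central_eq_zero (hα : ∀ x : L, ⁅x, α⁆ = 0) (x : L) :
    killingForm ℝ L x α = 0 := by
  have : LieAlgebra.ad ℝ L α = 0 := by
    ext y
    rw [LieAlgebra.ad_apply, ← lie_skew, hα, neg_zero, LinearMap.zero_apply]
  rw [killingForm_apply_apply, this, LinearMap.comp_zero, map_zero]

/-- If the Killing radical `N` of `α^⊥` is non-degenerate modulo `α`, then the Killing form vanishes
on `α^⊥`. Indeed, the Killing form is non-degenerate modulo `α` on `K = N^⊥`. The Killing complement
`K'` of `K` satisfies `K + K' = L` and `[K', K] ⊆ ℝα`, so that some `H ∈ K'` not orthogonal to `α`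
centralizes `K`. This says that the derivation of `K/α` given by the double extension is inner. Now
`K ∩ H^⊥` is a non-degenerate ideal, hence zero. -/
theorem killingForm_eq_zero_of_nondegenerate (hind : IsIndecomposable Φ) (hα0 : α ≠ 0)
    (hα : ∀ x : L, ⁅x, α⁆ = 0) (hαα : Φ.form α α = 0)
    (hN : ∀ x ∈ killingRadical Φ α, (∀ y ∈ killingRadical Φ α, Φ.form y x = 0) →
      ∃ t : ℝ, x = t • α) {x y : L} (hx : Φ.form α x = 0) (hy : Φ.form α y = 0) :
    killingForm ℝ L x y = 0 := by
  set N := killingRadical Φ α with hNdef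
  have hκs (x y : L) : killingForm ℝ L x y = killingForm ℝ L y x :=
    LieModule.traceForm_comm ℝ L L x y
  have hαN : α ∈ N := mem_killingRadical.mpr ⟨hαα, fun y _ => killingForm_central_eq_zero hα y⟩
  let K : Submodule ℝ L := LinearMap.BilinForm.orthogonal Φ.form N
  have hK (k) : k ∈ K ↔ ∀ y ∈ N, Φ.form y k = 0 := LinearMap.BilinForm.mem_orthogonal_iff
  have hKE (k) (hk : k ∈ K) : Φ.form α k = 0 := (hK k).mp hk α hαN
  have hNα (y) (hy : y ∈ N) : Φ.form y α = 0 :=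
    (Φ.symm.eq _ _).trans (mem_killingRadical.mp hy).1
  have hαK : α ∈ K := (hK α).mpr hNα
  have hKN (y) (hy : ∀ k ∈ K, Φ.form k y = 0) : y ∈ N := by
    rw [← LinearMap.BilinForm.orthogonal_orthogonal Φ.nondegenerate Φ.symm.isRefl N]
    exact LinearMap.BilinForm.mem_orthogonal_iff.mpr hy
  have hKlie (x : L) (k) (hk : k ∈ K) : ⁅x, k⁆ ∈ K := (hK _).mpr fun y hy => by
    rw [← neg_eq_zero, ← Φ.invariant]
    exact (hK k).mp hk _ (lie_mem_killingRadical hα x hy)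
  -- The orthogonal complement of `N + K` is `K ∩ N = ℝα`, whence `N + K = α^⊥`.
  have hsup : ∀ y, Φ.form α y = 0 → y ∈ N ⊔ K := fun y hy => by
    rw [← LinearMap.BilinForm.orthogonal_orthogonal Φ.nondegenerate Φ.symm.isRefl (N ⊔ K),
      LinearMap.BilinForm.mem_orthogonal_iff]
    intro z hz
    rw [LinearMap.BilinForm.mem_orthogonal_iff] at hz
    obtain ⟨t, rfl⟩ := hN z (hKN z fun k hk => hz k (Submodule.mem_sup_right hk))
      fun n hn => hz n (Submodule.mem_sup_left hn)
    change Φ.form (t • α) y = 0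
    rw [LinearMap.map_smul₂, hy, smul_zero]
  let K' : Submodule ℝ L := LinearMap.BilinForm.orthogonal (killingForm ℝ L) K
  have hK' (z) : z ∈ K' ↔ ∀ k ∈ K, killingForm ℝ L k z = 0 :=
    LinearMap.BilinForm.mem_orthogonal_iff
  have hK'lie (x : L) (z) (hz : z ∈ K') : ⁅x, z⁆ ∈ K' := (hK' _).mpr fun k hk => by
    rw [← neg_eq_zero, ← LieModule.traceForm_lieInvariant ℝ L L x k z]
    exact (hK' z).mp hz _ (hKlie x k hk)
  have hinf (x) (hxK : x ∈ K) (hxK' : x ∈ K') : ∃ t : ℝ, x = t • α := by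
    refine hN x (mem_killingRadical.mpr ⟨hKE x hxK, fun y hy => ?_⟩) ((hK x).mp hxK)
    obtain ⟨n, hn, k, hk, rfl⟩ := Submodule.mem_sup.mp (hsup y hy)
    rw [map_add, LinearMap.add_apply, (hK' x).mp hxK' k hk, add_zero, hκs]
    exact (mem_killingRadical.mp hn).2 x (hKE x hxK)
  have hspan : Module.finrank ℝ (ℝ ∙ α) = 1 := finrank_span_singleton hα0
  -- Count dimensions: `K ∩ K'` is at most a line, and `α ∈ K` lies in the kernel of the Killing
  -- form.
  have htop : K ⊔ K' = ⊤ := by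
    have h1 : Module.finrank ℝ (K ⊓ K' : Submodule ℝ L) ≤ 1 := by
      rw [← hspan]
      refine Submodule.finrank_mono fun x hx => ?_
      obtain ⟨t, ht⟩ := hinf x hx.1 hx.2
      exact Submodule.mem_span_singleton.mpr ⟨t, ht.symm⟩
    have h2 : 1 ≤ Module.finrank ℝ
        (K ⊓ LinearMap.BilinForm.orthogonal (killingForm ℝ L) ⊤ : Submodule ℝ L) := by
      rw [← hspan]
      refine Submodule.finrank_mono ?_
      rw [Submodule.span_singleton_le_iff_mem]
      exact ⟨hαK, LinearMap.BilinForm.mem_orthogonal_iff.mpr fun y _ =>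
        killingForm_central_eq_zero hα y⟩
    have h3 := LinearMap.BilinForm.finrank_add_finrank_orthogonal
      (B := killingForm ℝ L) (fun x y h => (hκs y x).trans h) K
    have h4 := Submodule.finrank_sup_add_finrank_inf_eq K K'
    have h5 := Submodule.finrank_le (K ⊔ K')
    refine Submodule.eq_top_of_finrank_eq (le_antisymm h5 ?_)
    change Module.finrank ℝ K + Module.finrank ℝ K' = _ at h3
    omega
  obtain ⟨H, hH, hαH⟩ : ∃ H ∈ K', Φ.form α H ≠ 0 := by
    by_contra! hcon
    refine hα0 (Φ.nondegenerate.1 α fun z => ?_)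
    obtain ⟨k, hk, k', hk', rfl⟩ := Submodule.mem_sup.mp (htop ▸ Submodule.mem_top : z ∈ K ⊔ K')
    rw [map_add, hKE k hk, hcon k' hk', add_zero]
  have hHα : Φ.form H α ≠ 0 := fun h => hαH ((Φ.symm.eq _ _).trans h)
  have hHK (k) (hk : k ∈ K) : ⁅H, k⁆ = 0 := by
    obtain ⟨t, ht⟩ := hinf ⁅H, k⁆ (hKlie H k hk) (by
      rw [← lie_skew]
      exact K'.neg_mem (hK'lie k H hH))
    have h1 := form_lie_self_eq_zero (Φ := Φ) H k
    rw [ht, LinearMap.map_smul₂, smul_eq_mul] at h1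
    rw [ht, (mul_eq_zero.mp h1).resolve_right hαH, zero_smul]
  have hsub (k) (hk : k ∈ K) :
      k - (Φ.form H k / Φ.form H α) • α ∈ K ⊓ LinearMap.ker (Φ.form H) :=
    ⟨K.sub_mem hk (K.smul_mem _ hαK), by simp [div_mul_cancel₀ _ hHα]⟩
  have hbot := hind.eq_bot (K ⊓ LinearMap.ker (Φ.form H))
    (by
      rintro x k ⟨hk, -⟩
      refine ⟨hKlie x k hk, LinearMap.mem_ker.mpr ?_⟩
      rw [← neg_eq_zero, ← Φ.invariant, ← lie_skew, map_neg,
        LinearMap.neg_apply, Φ.invariant, hHK k hk, map_zero, neg_zero, neg_zero])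
    (by
      rintro z ⟨hz, hHz⟩ h
      obtain ⟨t, rfl⟩ := hN z (hKN z fun k hk => by
        have h1 := h _ (hsub k hk)
        have h2 : Φ.form z α = 0 := (Φ.symm.eq _ _).trans (hKE z hz)
        rw [map_sub, map_smul, h2, smul_zero, sub_zero] at h1
        exact (Φ.symm.eq _ _).trans h1) ((hK z).mp hz)
      have hHz' : Φ.form H (t • α) = 0 := hHz
      rw [map_smul, smul_eq_mul] at hHz'
      rw [(mul_eq_zero.mp hHz').resolve_right hHα, zero_smul])
    hα0 (fun w hw => (Φ.symm.eq _ _).trans (hKE w hw.1))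
  refine (mem_killingRadical.mp (hKN y fun k hk => ?_)).2 x hx
  have h1 := hsub k hk
  rw [hbot, Submodule.mem_bot, sub_eq_zero] at h1
  rw [h1, LinearMap.map_smul₂, hy, smul_zero]

/-- If the centre is spanned by `α`, then the Killing radical `N` of `α^⊥` is non-degenerate
modulo `α`. Otherwise `N ∩ N^⊥` is spanned by `α` and one more null vector `β`. Fix `H` with
`⟨α, H⟩ = 1`; modulo `α` the vector `β` is an eigenvector of `ad H`, for an eigenvalue `c`. If
`c = 0` then `β` is central. If `c ≠ 0` then `ad H` has an eigenvector `γ` for `-c`, and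
`⟨β, γ⟩ ≠ 0`. By invariance `κ(γ, γ) = 0`, whence `[γ, α^⊥] ⊆ ℝα` and `γ ∈ N`, although `β ∈ N^⊥`. -/
theorem killingRadical_nondegenerate (hα0 : α ≠ 0) (hα : ∀ x : L, ⁅x, α⁆ = 0)
    (hcen : ∀ z : L, (∀ x : L, ⁅x, z⁆ = 0) → ∃ t : ℝ, z = t • α)
    (hE : IsSemiLorentzian Φ.form (LinearMap.ker (Φ.form α))) {β : L}
    (hβN : β ∈ killingRadical Φ α) (hβ : ∀ y ∈ killingRadical Φ α, Φ.form y β = 0) :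
    ∃ t : ℝ, β = t • α := by
  by_contra hβα
  have hαβ : Φ.form α β = 0 := (mem_killingRadical.mp hβN).1
  have hββ : Φ.form β β = 0 := hβ β hβN
  have hrad {v : L} (hv : ¬∃ t : ℝ, v = t • α) : ∃ z ∈ LinearMap.ker (Φ.form α),
      Φ.form v z ≠ 0 := by
    by_contra! hcon
    exact hv (exists_eq_smul_of_orthogonal hα0 hcon)
  have hnull {v u : L} (hαv : Φ.form α v = 0) (hvv : Φ.form v v = 0) (hv : ¬∃ t : ℝ, v = t • α)
      (hαu : Φ.form α u = 0) (hvu : Φ.form v u = 0) (huu : Φ.form u u = 0) :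
      ∃ t s : ℝ, u = t • v + s • α := by
    obtain ⟨t, ht⟩ := (hE.nonneg_of_null Φ.symm hαv hvv (hrad hv) hαu hvu).2 huu
    obtain ⟨s, hs⟩ := exists_eq_smul_of_orthogonal hα0 ht
    exact ⟨t, s, by rw [← hs, add_sub_cancel]⟩
  -- The ideal `N ∩ N^⊥` is totally isotropic, hence spanned by `β` and `α`.
  have hlieβ (x : L) : ∃ t s : ℝ, ⁅x, β⁆ = t • β + s • α := by
    have h1 := lie_mem_killingRadical hα x hβN
    have h2 (y) (hy : y ∈ killingRadical Φ α) : Φ.form y ⁅x, β⁆ = 0 := by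
      rw [← neg_eq_zero, ← Φ.invariant]
      exact hβ _ (lie_mem_killingRadical hα x hy)
    exact hnull hαβ hββ hβα (mem_killingRadical.mp h1).1 (h2 β hβN) (h2 _ h1)
  obtain ⟨e, he, hee⟩ := hE.exists_neg
  have heβ : Φ.form β e ≠ 0 := fun h0 => hβα (exists_eq_smul_of_orthogonal hα0 fun z hz =>
    hE.radical e he hee β hαβ ((Φ.symm.eq _ _).trans h0) hββ z hz)
  rw [LinearMap.mem_ker] at he
  have hlieE' (x : L) (hxβ : Φ.form β x ≠ 0) (hx : Φ.form α x = 0) :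
      ∃ s : ℝ, ⁅x, β⁆ = s • α := by
    obtain ⟨t, s, hts⟩ := hlieβ x
    have h1 := form_lie_self_eq_zero (Φ := Φ) x β
    simp only [hts, map_add, LinearMap.add_apply, LinearMap.map_smul₂, hx, smul_eq_mul, mul_zero,
      add_zero] at h1
    rw [(mul_eq_zero.mp h1).resolve_right hxβ, zero_smul, zero_add] at hts
    exact ⟨s, hts⟩
  have hlieE (x : L) (hx : Φ.form α x = 0) : ∃ s : ℝ, ⁅x, β⁆ = s • α := by
    by_cases hxβ : Φ.form β x = 0
    · obtain ⟨s₁, hs₁⟩ := hlieE' e heβ he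
      obtain ⟨s₂, hs₂⟩ := hlieE' (x + e) (by simpa [hxβ] using heβ) (by simp [hx, he])
      refine ⟨s₂ - s₁, ?_⟩
      rw [sub_smul, ← hs₁, ← hs₂, add_lie, add_sub_cancel_right]
    · exact hlieE' x hxβ hx
  obtain ⟨z, hz⟩ : ∃ z, Φ.form α z ≠ 0 := by
    by_contra! hcon
    exact hα0 (Φ.nondegenerate.1 α hcon)
  obtain ⟨H, hαH⟩ : ∃ H, Φ.form α H = 1 := ⟨(Φ.form α z)⁻¹ • z, by simp [hz]⟩
  obtain ⟨c, c', hc⟩ := hlieβ H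
  have hlieE_eq (x : L) (hx : Φ.form α x = 0) : ⁅x, β⁆ = (-c * Φ.form β x) • α := by
    obtain ⟨s, hs⟩ := hlieE x hx
    have h1 : Φ.form ⁅x, β⁆ H = -Φ.form ⁅H, β⁆ x := by
      rw [Φ.invariant, ← lie_skew, map_neg, neg_neg, Φ.invariant, neg_neg]
    simp only [hs, hc, map_add, LinearMap.add_apply, LinearMap.map_smul₂, hαH, hx, smul_eq_mul,
      mul_one, mul_zero, add_zero] at h1
    rw [hs, h1, neg_mul]
  have hsplit (x : L) : Φ.form α (x - Φ.form α x • H) = 0 := by simp [hαH]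
  rcases eq_or_ne c 0 with rfl | hc0
  · refine hβα (hcen β fun x => ?_)
    rw [zero_smul, zero_add] at hc
    have h1 := form_lie_self_eq_zero (Φ := Φ) H β
    rw [hc, LinearMap.map_smul₂, hαH, smul_eq_mul, mul_one] at h1
    rw [h1, zero_smul] at hc
    have h2 := hlieE_eq _ (hsplit x)
    rwa [sub_lie, smul_lie, hc, smul_zero, sub_zero, neg_zero, zero_mul, zero_smul] at h2
  set β' := β + (c' / c) • α with hβ'
  have hHβ' : ⁅H, β'⁆ = c • β' := by
    rw [hβ', lie_add, lie_smul, hα, smul_zero, add_zero, hc, smul_add, smul_smul,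
      mul_div_cancel₀ _ hc0]
  have hβ'0 : β' ≠ 0 := fun h0 => hβα ⟨-(c' / c), by
    rw [neg_smul]
    exact eq_neg_of_add_eq_zero_left h0⟩
  obtain ⟨γ, hγ0, hHγ⟩ := exists_eigenvector_neg (T := LieAlgebra.ad ℝ L H) Φ.nondegenerate
    (fun x y => Φ.invariant H x y) hβ'0 hHβ'
  have hγγ := null_of_eigenvector Φ.symm (fun x y => Φ.invariant H x y) (neg_ne_zero.mpr hc0) hHγ
  rw [LieAlgebra.ad_apply] at hHγ
  have hαγ : Φ.form α γ = 0 := by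
    have h1 := form_lie_eq_zero_of_central (Φ := Φ) hα H γ
    rw [hHγ, map_smul, smul_eq_mul] at h1
    exact (mul_eq_zero.mp h1).resolve_left (neg_ne_zero.mpr hc0)
  have hγα : ¬∃ t : ℝ, γ = t • α := by
    rintro ⟨t, ht⟩
    rw [ht, lie_smul, hα, smul_zero, ← ht] at hHγ
    exact hγ0 ((smul_eq_zero.mp hHγ.symm).resolve_left (neg_ne_zero.mpr hc0))
  have hβγ : Φ.form β γ ≠ 0 := fun h0 => by
    obtain ⟨t, s, hts⟩ := hnull hαβ hββ hβα hαγ h0 hγγ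
    have h1 : γ = t • β' + (s - t * (c' / c)) • α := by
      rw [hts, hβ']
      module
    have h2 : (2 * c * t) • β' = (-c * (s - t * (c' / c))) • α := by
      have h3 := hHγ
      rw [h1, lie_add, lie_smul, lie_smul, hα, smul_zero, add_zero, hHβ', smul_add] at h3
      rw [← sub_eq_zero] at h3 ⊢
      rw [← h3]
      module
    by_cases ht : t = 0
    · exact hγα ⟨s, by rw [hts, ht, zero_smul, zero_add]⟩
    · have h4 : 2 * c * t ≠ 0 := mul_ne_zero (mul_ne_zero two_ne_zero hc0) ht
      have h5 : β' = ((2 * c * t)⁻¹ * (-c * (s - t * (c' / c)))) • α := by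
        rw [mul_smul, ← h2, inv_smul_smul₀ h4]
      refine hβα ⟨(2 * c * t)⁻¹ * (-c * (s - t * (c' / c))) - c' / c, ?_⟩
      rw [sub_smul, ← h5, hβ', add_sub_cancel_right]
  have hγβ : Φ.form γ β ≠ 0 := fun h0 => hβγ ((Φ.symm.eq _ _).trans h0)
  have hκγ : killingForm ℝ L γ γ = 0 := by
    have h1 := LieModule.traceForm_apply_lie_apply ℝ L L H γ γ
    rw [hHγ, lie_self, map_zero, LinearMap.map_smul₂, smul_eq_mul] at h1
    exact (mul_eq_zero.mp h1).resolve_left (neg_ne_zero.mpr hc0)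
  have hγlieβ : ⁅γ, β⁆ = (-c * Φ.form β γ) • α := hlieE_eq γ hαγ
  have hγlie' (f : L) (hf : Φ.form α f = 0) (hγf : Φ.form γ f = 0) :
      ∃ t : ℝ, ⁅γ, f⁆ = t • α := by
    have h1 := form_lie_lie_eq_zero_of_killingForm hα
      (fun g hg hγg => (hE.nonneg_of_null Φ.symm hαγ hγγ (hrad hγα) hg hγg).1)
      (fun g hg hγg hgg => by
        obtain ⟨t, s, rfl⟩ := hnull hαγ hγγ hγα hg hγg hgg
        rw [lie_add, lie_smul, lie_smul, lie_self, hα, smul_zero, smul_zero, add_zero])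
      hκγ hf hγf
    obtain ⟨t, s, hts⟩ := hnull hαγ hγγ hγα (form_lie_eq_zero_of_central hα γ f)
      ((Φ.symm.eq _ _).trans (form_lie_self_eq_zero γ f)) h1
    have h2 := Φ.invariant γ f β
    have h3 : Φ.form f α = 0 := (Φ.symm.eq _ _).trans hf
    simp only [hγlieβ, hts, map_smul, h3, map_add, LinearMap.add_apply, LinearMap.smul_apply, hαβ,
      add_zero, neg_zero, smul_eq_mul, mul_zero] at h2
    rw [(mul_eq_zero.mp h2).resolve_right hγβ, zero_smul, zero_add] at hts
    exact ⟨s, hts⟩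
  have hγlie (y : L) (hy : Φ.form α y = 0) : ∃ t : ℝ, ⁅γ, y⁆ = t • α := by
    obtain ⟨t, ht⟩ := hγlie' (y - (Φ.form γ y / Φ.form γ β) • β) (by simp [hy, hαβ])
      (by simp [div_mul_cancel₀ _ hγβ])
    rw [lie_sub, lie_smul, hγlieβ, sub_eq_iff_eq_add, smul_smul, ← add_smul] at ht
    exact ⟨_, ht⟩
  refine hγβ (hβ γ (mem_killingRadical.mpr ⟨hαγ, fun y hy => ?_⟩))
  -- `ad γ ∘ ad y` maps into the line through `α`, on which it vanishes.
  have hline (x : L) : (LieAlgebra.ad ℝ L γ ∘ₗ LieAlgebra.ad ℝ L y) x ∈ (ℝ ∙ α) := by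
    obtain ⟨t, ht⟩ := hγlie ⁅y, x⁆ (form_lie_eq_zero_of_central hα y x)
    exact Submodule.mem_span_singleton.mpr ⟨t, ht.symm⟩
  rw [LieModule.traceForm_comm, ← killingForm, killingForm_apply_apply,
    ← LinearMap.trace_restrict_eq_of_forall_mem (ℝ ∙ α) _ hline]
  convert map_zero (LinearMap.trace ℝ (ℝ ∙ α))
  ext ⟨x, hx⟩
  obtain ⟨t, rfl⟩ := Submodule.mem_span_singleton.mp hx
  simp [hα]

end MetricLie

theorem mainTheorem9 {𝔡 : Type*} [LieRing 𝔡] [LieAlgebra ℝ 𝔡] [FiniteDimensional ℝ 𝔡]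
    (Φ : MetricLie.ScalarProduct 𝔡) (n : ℕ) (hn : 2 ≤ n)
    (hsig : MetricLie.HasSignature Φ 2 (n - 2))
    (hind : MetricLie.IsIndecomposable Φ) :
    (Module.finrank ℝ (LieAlgebra.center ℝ 𝔡) = 1 → MetricLie.IsListed Φ n) ∧
    (∀ {𝔤 : Type*} [LieRing 𝔤] [LieAlgebra ℝ 𝔤] [FiniteDimensional ℝ 𝔤] [IsLieAbelian 𝔤]
      (Ψ : MetricLie.ScalarProduct 𝔤) (_ : MetricLie.HasSignature Ψ 1 (n - 3))
      (A : MetricLie.AntisymmDerivation Ψ),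
      MetricLie.IsIsomorphic Φ (MetricLie.DoubleExtension.scalarProduct A) →
        MetricLie.IsListed Φ n) := by
  constructor
  · intro hcenter
    obtain ⟨⟨α, hαc⟩, hα0, hspan⟩ := finrank_eq_one_iff'.mp hcenter
    have hα : ∀ x : 𝔡, ⁅x, α⁆ = 0 := (LieModule.mem_maxTrivSubmodule ℝ 𝔡 𝔡 α).mp hαc
    replace hα0 : α ≠ 0 := fun h => hα0 (Subtype.ext h)
    have hαα := hind.null_of_central (by rw [hsig.finrank_eq]; omega) hα
    have hE := MetricLie.isSemiLorentzian_orthogonal Φ.symm Φ.nondegenerate hsig.1 hα0 hαα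
    have hcen (z : 𝔡) (hz : ∀ x : 𝔡, ⁅x, z⁆ = 0) : ∃ t : ℝ, z = t • α := by
      obtain ⟨t, ht⟩ := hspan ⟨z, (LieModule.mem_maxTrivSubmodule ℝ 𝔡 𝔡 z).mpr hz⟩
      exact ⟨t, (congrArg Subtype.val ht).symm⟩
    exact MetricLie.isListed_of_central hn hsig hind hα0 hα fun x y hx hy =>
      MetricLie.exists_lie_eq_smul_of_killingForm hα0 hα hE
        (fun x y hx hy => MetricLie.killingForm_eq_zero_of_nondegenerate hind hα0 hα hαα
          (fun β hβN hβ => MetricLie.killingRadical_nondegenerate hα0 hα hcen hE hβN hβ) hx hy)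
        hx hy
  · rintro 𝔤 _ _ _ _ Ψ - A ⟨e, he⟩
    let a : MetricLie.DoubleExtension A := ((1, 0, 0) : ℝ × 𝔤 × ℝ)
    have ha1 : a.1 = 1 := rfl
    have ha2 : a.2.1 = 0 := rfl
    have ha3 : a.2.2 = 0 := rfl
    have hform (x : 𝔡) : Φ.form (e.symm a) x = (e x).2.2 := by
      rw [← he, LieEquiv.apply_symm_apply]
      simp [MetricLie.DoubleExtension.scalarProduct, ha1, ha2, ha3]
    have hinj (x y : 𝔡) (h : e x = e y) : x = y := e.injective h
    refine MetricLie.isListed_of_central hn hsig hind (α := e.symm a) ?_ ?_ ?_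
    · intro h0
      have h1 : a = 0 := by rw [← e.apply_symm_apply a, h0, map_zero]
      exact one_ne_zero (congrArg (fun u : MetricLie.DoubleExtension A => u.1) h1)
    · intro x
      refine hinj _ _ ?_
      rw [LieEquiv.map_lie, LieEquiv.apply_symm_apply, map_zero]
      ext <;> simp [ha2, ha3]
    · intro x y hx hy
      rw [hform] at hx hy
      refine ⟨Ψ.form (A.der (e x).2.1) (e y).2.1, hinj _ _ ?_⟩
      rw [LieEquiv.map_lie, map_smul, LieEquiv.apply_symm_apply]
      ext
      · simp [ha1]
      · simpa [ha2, hx, hy] using trivial_lie_zero 𝔤 𝔤 (e x).2.1 (e y).2.1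
      · simp [ha3]
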